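/- **Theorem 1.** Let $N,K,H,A,I,J$ be positive integers with $N\ge 2$, $A\le I\le J\le H$ and $I+2A<J$, put $L=J-I-2A$, and let $q>H$ be a prime power. Let $\mathbf A=[a_{j,k}]$ be a $(K,F,Z,S)$ placement delivery array, i.e. an $F\times K$ array ($F\ge1$) with exactly $Z$ entries $*$ in each column, the other entries being symbols of $\{1,\dots,S\}$, each occurring at least once, such that two distinct entries $a_{j,k}=a_{j',k'}=s\in\{1,\dots,S\}$ always satisfy $j\ne j'$, $k\neq k'$ and $a_{j,k'}=a_{j',k}=*$. *System.* There are $N$ files $W_1,\dots,W_N\in\mathbb F_q^B$, $K$ users and $H$ servers. A scheme of file length $B$ fixes random variables $U$ and $P_1,\dots,P_K$ (the latter on a finite alphabet), and functions that determine the content $Z_h$ of server $h$ from $(W_{[N]},U)$, the cache $C_k$ of user $k$ from $(P_k,U,W_{[N]})$, the query $Q_{k,h}$ of user $k$ to server $h$ from the demand vector $\mathbf d_k\in\mathbb F_q^N$ and $P_k$, and the signal $X_h$ of server $h$ from $(Z_h,Q_{[K],h})$; all of these are vectors over $\mathbb F_q$ of fixed lengths. The variables $W_1,\dots,W_N,\mathbf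 d_1,\dots,\mathbf d_K,P_1,\dots,P_K,U$ are independent, and the laws of the files and demands are arbitrary. User $k$ wants $W_{\mathbf d_k}=\sum_n d_{k,n}W_n$. The servers in an unknown set $\mathcal A\subseteq[H]$, $|\mathcal A|\le A$, are adversarial: they may replace their signals by $\widetilde X_{\mathcal A}$ with values in the same spaces, where $I(W_{[N]},Z_{[H]\setminus\mathcal A},Q_{[K],[H]\setminus\mathcal A},\mathbf d_{[K]};\widetilde X_{\mathcal A}\mid Z_{\mathcal A},Q_{[K],\mathcal A})=0$, and their contents by $\widetilde Z_{\mathcal A}$, where $I(W_{[N]},Z_{[H]\setminus\mathcal A};\widetilde Z_{\mathcal A}\mid Z_{\mathcal A})=0$. The memory size, the storage size and the communication load of the scheme are the length of a cache, the length of the content of a server, and the maximal length of a signal, each divided by $B$. The scheme is an *RSP-LFR-BA scheme* if, for all such $\mathcal A$, $\widetilde X$, $\widetilde Z$, all $\mathcal I,\mathcal J\subseteq [H]$ with $|\mathcal I|=I$, $|\mathcal J|=J$, all $k\in[K]$ and $\mathcal S\subseteq[K]$: 1. (server security) $I(W_{[N]};Z_{\mathcal I})=0$; 2. (robust recovery)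 $H(W_{[N]}\mid Z_{\mathcal J\setminus\mathcal A},\widetilde Z_{\mathcal J\cap\mathcal A})=0$; 3. (robust decoding) $H(W_{\mathbf d_k}\mid X_{\mathcal J\setminus\mathcal A},\widetilde X_{\mathcal J\cap\mathcal A},\mathbf d_k,C_k)=0$; 4. (signal security) $I(W_{[N]};X_{[H]\setminus\mathcal A},\widetilde X_{\mathcal A})=0$; 5. (demand privacy) $I(\mathbf d_{[K]\setminus\mathcal S};C_{\mathcal S},\mathbf d_{\mathcal S},Q_{[K],[H]},Z_{[H]}\mid W_{[N]})=0$; and if the recovery in 2 and the decoding in 3 can be done by maps that depend on $\mathcal J$ (and $k$) only, not on $\mathcal A$ or on the behaviour of the adversarial servers. It has *subpacketization* $m$ if it can be implemented by partitioning each file into $m$ packets of equal length: everything stored, cached or sent consists of whole packets, each a linear combination of file packets and random key packets (for the contents of servers and caches) or of packets held by the server (for the signals), and, besides, of symbols depending only on $P_k$ (in the cache of user $k$) or only on the queries (in the signals); the coefficients may depend on $P_k$, respectively on the queries. *Claim.* There are RSP-LFR-BA schemes with subpacketization $LF$, one for each file length $B\in\{LF,2LF,3LF,\dots\}$, that achieve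 the memory-storage-communication triple $$\Big(1+\frac ZF(N-1),\ \frac1L\Big(N+\frac SF\Big),\ \frac S{LF}\Big)\in[1,N]\times\mathbb R_{\ge0}\times\mathbb R_{\ge0},$$ that is, for every $\varepsilon>0$ and all sufficiently large such $B$, the memory size, the storage size and the communication load are less than the respective component plus $\varepsilon$. -/

import Mathlib

open MeasureTheory

universe u

/-! ## Discrete information measures

Random variables take values in finite alphabets; `prob μ X x` is `P(X = x)`. -/

section Information

variable {Ω α β γ : Type*} [MeasurableSpace Ω]

/-- The probability mass function of `X` under `μ`. -/
noncomputable def prob (μ : Measure Ω) (X : Ω → α) (x : α) : ℝ :=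
  μ.real (X ⁻¹' {x})

/-- A map into a discrete alphabet is a random variable if all its fibres are events. -/
def IsRV (X : Ω → α) : Prop :=
  ∀ x, MeasurableSet (X ⁻¹' {x})

/-- Conditional entropy `H(X | Y) = - ∑ p(x,y) log (p(x,y) / p(y))`. -/
noncomputable def condEntropy [Fintype α] [Fintype β] (μ : Measure Ω)
    (X : Ω → α) (Y : Ω → β) : ℝ :=
  - ∑ x, ∑ y, prob μ (fun ω => (X ω, Y ω)) (x, y) *
      Real.log (prob μ (fun ω => (X ω, Y ω)) (x, y) / prob μ Y y)

/-- Mutual information `I(X; Y) = ∑ p(x,y) log (p(x,y) / (p(x) p(y)))`. -/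
noncomputable def mutualInfo [Fintype α] [Fintype β] (μ : Measure Ω)
    (X : Ω → α) (Y : Ω → β) : ℝ :=
  ∑ x, ∑ y, prob μ (fun ω => (X ω, Y ω)) (x, y) *
      Real.log (prob μ (fun ω => (X ω, Y ω)) (x, y) / (prob μ X x * prob μ Y y))

/-- Conditional mutual information
`I(X; Y | V) = ∑ p(x,y,v) log (p(v) p(x,y,v) / (p(x,v) p(y,v)))`. -/
noncomputable def condMutualInfo [Fintype α] [Fintype β] [Fintype γ] (μ : Measure Ω)
    (X : Ω → α) (Y : Ω → β) (V : Ω → γ) : ℝ :=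
  ∑ x, ∑ y, ∑ v, prob μ (fun ω => (X ω, Y ω, V ω)) (x, y, v) *
      Real.log (prob μ V v * prob μ (fun ω => (X ω, Y ω, V ω)) (x, y, v) /
        (prob μ (fun ω => (X ω, V ω)) (x, v) * prob μ (fun ω => (Y ω, V ω)) (y, v)))

end Information

/-! ## Placement delivery arrays -/

/-- `a` is a `(K, F, Z, S)` placement delivery array: an `F × K` array whose entries are either
`*` (that is, `none`) or one of the `S` ordinary symbols, with `Z` stars in each column, each
ordinary symbol occurring, and two distinct entries holding the same ordinary symbol only if they
lie in distinct rows and columns and the two opposite corners are stars. -/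
structure IsPDA {K F S : ℕ} (Z : ℕ) (a : Fin F → Fin K → Option (Fin S)) : Prop where
  stars : ∀ k, (Finset.univ.filter fun j => a j k = none).card = Z
  occurs : ∀ s, ∃ j k, a j k = some s
  distinct : ∀ j k j' k' s, (j, k) ≠ (j', k') → a j k = some s → a j' k' = some s →
    j ≠ j' ∧ k ≠ k' ∧ a j k' = none ∧ a j' k = none

/-! ## The cache-aided multi-server multi-user system -/

/-- A scheme for `N` files in `𝔽 ^ B`, `K` users and `H` servers: the alphabets and laws of the
client's randomness `U` and of the users' private randomness `P_k`, the lengths (in symbols of `𝔽`)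
of everything that is stored or sent, and the encoding functions. -/
structure Scheme (𝔽 : Type u) (N K H B : ℕ) where
  /-- alphabet of the client's randomness -/
  U : Type u
  /-- alphabet of the users' randomness -/
  P : Type u
  finiteP : Finite P
  lawU : PMF U
  lawP : Fin K → PMF P
  storeLen : ℕ
  cacheLen : ℕ
  queryLen : Fin K → Fin H → ℕ
  loadLen : Fin H → ℕ
  /-- content of server `h`, a function of the files and of `U` -/
  store : Fin H → (Fin N → Fin B → 𝔽) → U → Fin storeLen → 𝔽
  /-- cache content of user `k`, a function of `P_k`, `U` and the files -/
  cache : Fin K → P → U → (Fin N → Fin B → 𝔽) → Fin cacheLen → 𝔽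
  /-- query of user `k` to server `h`, a function of the demand of user `k` and of `P_k` -/
  query : ∀ (k : Fin K) (h : Fin H), (Fin N → 𝔽) → P → Fin (queryLen k h) → 𝔽
  /-- signal of server `h`, a function of its content and of the queries it receives -/
  signal : ∀ h : Fin H, (Fin storeLen → 𝔽) → (∀ k, Fin (queryLen k h) → 𝔽) → Fin (loadLen h) → 𝔽

namespace Scheme

variable {𝔽 : Type u} {N K H B : ℕ}

/-- Memory size of a user: cached symbols per file symbol. -/
noncomputable def memorySize (σ : Scheme 𝔽 N K H B) : ℝ := σ.cacheLen / B

/-- Storage size of a server: stored symbols per file symbol. -/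
noncomputable def storageSize (σ : Scheme 𝔽 N K H B) : ℝ := σ.storeLen / B

/-- Communication load: the largest number of symbols sent by a server, per file symbol. -/
noncomputable def commLoad (σ : Scheme 𝔽 N K H B) : ℝ :=
  (Finset.univ.sup σ.loadLen : ℕ) / B

/-- One operation of the scheme on a probability space: random files `W`, demands `d`, users'
randomness `P` and client's randomness `U`. The laws of `P_k` and `U` are those of the scheme, the
laws of the files and of the demands are arbitrary, and
`W_1, …, W_N, d_1, …, d_K, P_1, …, P_K, U` are mutually independent. -/
structure Realization (σ : Scheme 𝔽 N K H B) {Ω : Type u} [MeasurableSpace Ω]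
    (μ : Measure Ω) where
  W : Ω → Fin N → Fin B → 𝔽
  d : Ω → Fin K → Fin N → 𝔽
  P : Ω → Fin K → σ.P
  U : Ω → σ.U
  isRV_W : IsRV W
  isRV_d : IsRV d
  isRV_P : IsRV P
  isRV_U : IsRV U
  law_P : ∀ k p, μ {ω | P ω k = p} = σ.lawP k p
  law_U : ∀ x, μ {ω | U ω = x} = σ.lawU x
  indep : ∀ w e p x, μ {ω | W ω = w ∧ d ω = e ∧ P ω = p ∧ U ω = x} =
    (∏ n, μ {ω | W ω n = w n}) * (∏ k, μ {ω | d ω k = e k}) *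
      (∏ k, μ {ω | P ω k = p k}) * μ {ω | U ω = x}

/-- What arrives from the servers when those in `𝓐` replace their vector `x h` by `y h`. -/
def corrupt {β : Fin H → Type u} (𝓐 : Finset (Fin H)) (x y : ∀ h, β h) : ∀ h, β h :=
  fun h => if h ∈ 𝓐 then y h else x h

namespace Realization

variable {σ : Scheme 𝔽 N K H B} {Ω : Type u} [MeasurableSpace Ω] {μ : Measure Ω}

/-- Server contents `Z_h`. -/
def Z (ρ : σ.Realization μ) (ω : Ω) (h : Fin H) : Fin σ.storeLen → 𝔽 :=
  σ.store h (ρ.W ω) (ρ.U ω)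

/-- Cache contents `C_k`. -/
def C (ρ : σ.Realization μ) (ω : Ω) (k : Fin K) : Fin σ.cacheLen → 𝔽 :=
  σ.cache k (ρ.P ω k) (ρ.U ω) (ρ.W ω)

/-- `Q ω h k` is the query of user `k` to server `h`. -/
def Q (ρ : σ.Realization μ) (ω : Ω) (h : Fin H) (k : Fin K) : Fin (σ.queryLen k h) → 𝔽 :=
  σ.query k h (ρ.d ω k) (ρ.P ω k)

/-- Signals `X_h` of the servers when all of them operate normally. -/
def X (ρ : σ.Realization μ) (ω : Ω) (h : Fin H) : Fin (σ.loadLen h) → 𝔽 :=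
  σ.signal h (ρ.Z ω h) (ρ.Q ω h)

/-- The scalar linear function `W_{d_k}` demanded by user `k`. -/
def demanded [Field 𝔽] (ρ : σ.Realization μ) (k : Fin K) (ω : Ω) : Fin B → 𝔽 :=
  ∑ n, ρ.d ω k n • ρ.W ω n

variable [Fintype 𝔽]

/-- Erroneous contents that the servers in `𝓐` can provide: given what these servers hold, they
carry no information about the files and the contents of the other servers. Only the values at
`h ∈ 𝓐` matter. -/
def IsContentAttack (ρ : σ.Realization μ) (𝓐 : Finset (Fin H))
    (Z' : Ω → ∀ _ : Fin H, Fin σ.storeLen → 𝔽) : Prop :=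
  IsRV Z' ∧
    condMutualInfo μ (fun ω => (ρ.W ω, (𝓐ᶜ).restrict (ρ.Z ω)))
      (fun ω => 𝓐.restrict (Z' ω)) (fun ω => 𝓐.restrict (ρ.Z ω)) = 0

/-- Erroneous signals that the servers in `𝓐` can send: given the contents of these servers and the
queries they receive, the signals carry no information about the files, the demands, and the
contents and queries of the other servers. Only the values at `h ∈ 𝓐` matter. -/
def IsSignalAttack (ρ : σ.Realization μ) (𝓐 : Finset (Fin H))
    (X' : Ω → ∀ h : Fin H, Fin (σ.loadLen h) → 𝔽) : Prop :=
  IsRV X' ∧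
    condMutualInfo μ
      (fun ω => (ρ.W ω, (𝓐ᶜ).restrict (ρ.Z ω), (𝓐ᶜ).restrict (ρ.Q ω), ρ.d ω))
      (fun ω => 𝓐.restrict (X' ω))
      (fun ω => (𝓐.restrict (ρ.Z ω), 𝓐.restrict (ρ.Q ω))) = 0

/-- Any `I` servers together learn nothing about the files. -/
def ServerSecurity (ρ : σ.Realization μ) (I : ℕ) : Prop :=
  ∀ 𝓘 : Finset (Fin H), 𝓘.card = I →
    mutualInfo μ ρ.W (fun ω => 𝓘.restrict (ρ.Z ω)) = 0

/-- The files are determined by the contents provided by any `J` servers, in spite of at most `A`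
adversarial ones. -/
def RobustRecovery (ρ : σ.Realization μ) (A J : ℕ) : Prop :=
  ∀ 𝓐 𝓙 : Finset (Fin H), 𝓐.card ≤ A → 𝓙.card = J →
    ∀ Z', ρ.IsContentAttack 𝓐 Z' →
      condEntropy μ ρ.W (fun ω => 𝓙.restrict (corrupt 𝓐 (ρ.Z ω) (Z' ω))) = 0

/-- The demanded function of user `k` is determined by the signals of any `J` servers, its demand
and its cache, in spite of at most `A` adversarial servers. -/
def RobustDecoding [Field 𝔽] (ρ : σ.Realization μ) (A J : ℕ) : Prop :=
  ∀ (k : Fin K) (𝓐 𝓙 : Finset (Fin H)), 𝓐.card ≤ A → 𝓙.card = J →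
    ∀ X', ρ.IsSignalAttack 𝓐 X' →
      condEntropy μ (ρ.demanded k)
        (fun ω => (𝓙.restrict (corrupt 𝓐 (ρ.X ω) (X' ω)), ρ.d ω k, ρ.C ω k)) = 0

/-- A wiretapper of all delivered signals learns nothing about the files. -/
def SignalSecurity (ρ : σ.Realization μ) (A : ℕ) : Prop :=
  ∀ 𝓐 : Finset (Fin H), 𝓐.card ≤ A → ∀ X', ρ.IsSignalAttack 𝓐 X' →
    mutualInfo μ ρ.W (fun ω => corrupt 𝓐 (ρ.X ω) (X' ω)) = 0

/-- The users in `𝓢` together with all the servers learn nothing about the demands of the other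
users, given the files. -/
def DemandPrivacy (ρ : σ.Realization μ) : Prop :=
  ∀ 𝓢 : Finset (Fin K),
    condMutualInfo μ (fun ω => (𝓢ᶜ).restrict (ρ.d ω))
      (fun ω => (𝓢.restrict (ρ.C ω), 𝓢.restrict (ρ.d ω), ρ.Q ω, ρ.Z ω)) ρ.W = 0

end Realization

/-- Recovery of the files from any `J` servers by a decoder that knows neither which servers are
adversarial nor how they behave. -/
def ObliviousRecovery (σ : Scheme 𝔽 N K H B) (A J : ℕ) : Prop :=
  ∀ 𝓙 : Finset (Fin H), 𝓙.card = J →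
    ∃ dec : (∀ _ : 𝓙, Fin σ.storeLen → 𝔽) → Fin N → Fin B → 𝔽,
      ∀ 𝓐 : Finset (Fin H), 𝓐.card ≤ A →
        ∀ w, ∀ x ∈ σ.lawU.support, ∀ z : ∀ _ : Fin H, Fin σ.storeLen → 𝔽,
          dec (𝓙.restrict (corrupt 𝓐 (fun h => σ.store h w x) z)) = w

/-- Decoding of the demanded function of a user from the signals of any `J` servers by a decoder
that knows neither which servers are adversarial nor how they behave. -/
def ObliviousDecoding [Field 𝔽] (σ : Scheme 𝔽 N K H B) (A J : ℕ) : Prop :=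
  ∀ (k : Fin K) (𝓙 : Finset (Fin H)), 𝓙.card = J →
    ∃ dec : (∀ h : 𝓙, Fin (σ.loadLen h) → 𝔽) → (Fin N → 𝔽) → (Fin σ.cacheLen → 𝔽) → Fin B → 𝔽,
      ∀ 𝓐 : Finset (Fin H), 𝓐.card ≤ A →
        ∀ (w : Fin N → Fin B → 𝔽) (e : Fin K → Fin N → 𝔽) (p : Fin K → σ.P),
          (∀ i, p i ∈ (σ.lawP i).support) → ∀ x ∈ σ.lawU.support,
            ∀ y : ∀ h : Fin H, Fin (σ.loadLen h) → 𝔽,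
              dec (𝓙.restrict (corrupt 𝓐
                    (fun h => σ.signal h (σ.store h w x) fun i => σ.query i h (e i) (p i)) y))
                  (e k) (σ.cache k (p k) x w) = ∑ n, e k n • w n

/-- The scheme is robust, secure and private against blind and adversarial servers: the five
constraints hold in every operation of the scheme, whatever the laws of the independent files and
demands; and the decoders of the two robustness constraints need not know the adversary. -/
structure IsRSPLFRBA [Field 𝔽] [Fintype 𝔽] (σ : Scheme 𝔽 N K H B) (A I J : ℕ) : Prop where
  constraints : ∀ {Ω : Type u} [MeasurableSpace Ω] (μ : Measure Ω) [IsProbabilityMeasure μ]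
    (ρ : σ.Realization μ),
      ρ.ServerSecurity I ∧ ρ.RobustRecovery A J ∧ ρ.RobustDecoding A J ∧
        ρ.SignalSecurity A ∧ ρ.DemandPrivacy
  recovery : σ.ObliviousRecovery A J
  decoding : σ.ObliviousDecoding A J

/-- A packet-level implementation of a scheme in which each file is partitioned into `m` packets of
the same length `b`. Everything stored, cached or sent is made of whole packets of that length, each
of them a linear combination of whole packets: of file packets and key packets (functions of `U`)
for the contents of servers and caches, and of the packets held by the server for the signals. In
addition a cache holds some symbols that depend on the private randomness of the user only (which
may also determine the coefficients), and a signal holds some symbols that depend on the queries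
only (which may also determine the coefficients). -/
structure Packetization [Field 𝔽] (σ : Scheme 𝔽 N K H B) (m : ℕ) where
  b : ℕ
  fileSplit : Fin B ≃ Fin m × Fin b
  numKeys : ℕ
  keyPacket : σ.U → Fin numKeys → Fin b → 𝔽
  -- server contents
  numStore : ℕ
  storeSplit : Fin H → Fin σ.storeLen ≃ Fin numStore × Fin b
  storeFile : Fin H → Fin numStore → Fin N → Fin m → 𝔽
  storeKey : Fin H → Fin numStore → Fin numKeys → 𝔽
  store_eq : ∀ h w x i t, σ.store h w x ((storeSplit h).symm (i, t)) =
    (∑ n, ∑ j, storeFile h i n j * w n (fileSplit.symm (j, t))) +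
      ∑ v, storeKey h i v * keyPacket x v t
  -- cache contents
  cacheHead : ℕ
  numCache : ℕ
  cacheSplit : Fin K → Fin σ.cacheLen ≃ Fin cacheHead ⊕ Fin numCache × Fin b
  cacheHeader : Fin K → σ.P → Fin cacheHead → 𝔽
  cacheFile : Fin K → σ.P → Fin numCache → Fin N → Fin m → 𝔽
  cacheKey : Fin K → σ.P → Fin numCache → Fin numKeys → 𝔽
  cache_head : ∀ k p x w i, σ.cache k p x w ((cacheSplit k).symm (Sum.inl i)) = cacheHeader k p i
  cache_eq : ∀ k p x w i t, σ.cache k p x w ((cacheSplit k).symm (Sum.inr (i, t))) =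
    (∑ n, ∑ j, cacheFile k p i n j * w n (fileSplit.symm (j, t))) +
      ∑ v, cacheKey k p i v * keyPacket x v t
  -- signals
  signalHead : Fin H → ℕ
  numSignal : Fin H → ℕ
  signalSplit : ∀ h, Fin (σ.loadLen h) ≃ Fin (signalHead h) ⊕ Fin (numSignal h) × Fin b
  signalHeader : ∀ h, (∀ k, Fin (σ.queryLen k h) → 𝔽) → Fin (signalHead h) → 𝔽
  signalCoeff : ∀ h, (∀ k, Fin (σ.queryLen k h) → 𝔽) → Fin (numSignal h) → Fin numStore → 𝔽
  signal_head : ∀ h z q i,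
    σ.signal h z q ((signalSplit h).symm (Sum.inl i)) = signalHeader h q i
  signal_eq : ∀ h z q i t, σ.signal h z q ((signalSplit h).symm (Sum.inr (i, t))) =
    ∑ i', signalCoeff h q i i' * z ((storeSplit h).symm (i', t))

/-- The scheme can be implemented with subpacketization `m`: each file is partitioned into `m`
packets of equal length. -/
def HasSubpacketization [Field 𝔽] (σ : Scheme 𝔽 N K H B) (m : ℕ) : Prop :=
  Nonempty (σ.Packetization m)

/-- The schemes `σ b`, of file length `m * b`, achieve the memory-storage-communication triple
`(M, T, R)`: for every `ε > 0`, all of them with long enough files have memory size less than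
`M + ε`, storage size less than `T + ε` and communication load less than `R + ε`. -/
def Achieves {m : ℕ} (σ : ∀ b : ℕ, Scheme 𝔽 N K H (m * b)) (M T R : ℝ) : Prop :=
  (1 ≤ M ∧ M ≤ N ∧ 0 ≤ T ∧ 0 ≤ R) ∧
    ∀ ε > 0, ∃ b₀ : ℕ, ∀ b ≥ b₀,
      (σ b).memorySize < M + ε ∧ (σ b).storageSize < T + ε ∧ (σ b).commLoad < R + ε

end Scheme

/-! Each file is cut into `L * F` packets. For a file and a row of the array, its `L` packets are
the low coefficients of a polynomial with `L + I` coefficients, whose `I` top ones are uniform keys;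
server `h` stores its value at a nonzero point `α h`. The servers also hold shares of one uniformly
random polynomial per ordinary symbol `s`. The query of user `k` is the demand under a one-time pad,
`q k = e k + p k`. For each `s`, a server adds its key share to the combinations, with coefficients
`q k`, of the row shares at the cells holding `s`; it also repeats all queries.

Robustness: combining is linear, so for each `s` the honest signals are values of one polynomial
with `L + I = J - 2 * A` coefficients. Two explanations of the same `J` answers, each with at most
`A` errors, agree at `L + I` points, hence everywhere. User `k` caches the packets of the starred
rows and, elsewhere, key plus `p k` times the packets. The array property leaves one unknown cell
per symbol, and subtracting the cached value leaves the demanded packet (`demanded_eq_zero`).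

Secrecy: for any files there is a translation of the keys that cancels their effect on `I` servers
and on all signals (`exists_masking_keys`). The keys are uniform, so such observations are
independent of the files (`exists_factor_of_translation`). Adversarial signals are handled by
freezing their value and averaging with conditional independence. Demand privacy is the same
argument with the pads `p k` as keys.

Only the repeated queries, `K * N` symbols of fixed number, exceed the target triple, so they cost
nothing in the limit. -/

/-! ### Independence and vanishing information. -/

section Information

variable {Ω α β γ δ ε : Type*} [MeasurableSpace Ω] {μ : Measure Ω}

lemma IsRV.comp [Finite α] {X : Ω → α} (hX : IsRV X) (f : α → β) :
    IsRV (fun ω => f (X ω)) := by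
  intro y
  have : (fun ω => f (X ω)) ⁻¹' {y} = ⋃ x ∈ {x | f x = y}, X ⁻¹' {x} := by ext; simp
  rw [this]
  exact MeasurableSet.biUnion (Set.to_countable _) fun x _ => hX x

lemma IsRV.prodMk {X : Ω → α} {Y : Ω → β} (hX : IsRV X) (hY : IsRV Y) :
    IsRV (fun ω => (X ω, Y ω)) := by
  rintro ⟨x, y⟩
  have : (fun ω => (X ω, Y ω)) ⁻¹' {(x, y)} = X ⁻¹' {x} ∩ Y ⁻¹' {y} := by ext; simp
  rw [this]
  exact (hX x).inter (hY y)

lemma prob_nonneg (X : Ω → α) (x : α) : 0 ≤ prob μ X x := measureReal_nonneg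

lemma prob_comp [Fintype α] [DecidableEq β] [IsFiniteMeasure μ] {X : Ω → α} (hX : IsRV X)
    (f : α → β) (y : β) :
    prob μ (fun ω => f (X ω)) y = ∑ x, if f x = y then prob μ X x else 0 := by
  have : (fun ω => f (X ω)) ⁻¹' {y} = ⋃ x ∈ Finset.univ.filter (fun x => f x = y), X ⁻¹' {x} := by
    ext; simp
  rw [prob, this, measureReal_biUnion_finset, Finset.sum_filter]
  · rfl
  · intro x _ x' _ hxx
    exact Disjoint.preimage _ (by simpa using hxx)
  · exact fun x _ => hX x

lemma prob_eq_sum_right [Fintype α] [Fintype β] [IsFiniteMeasure μ] {X : Ω → α} {Y : Ω → β}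
    (hX : IsRV X) (hY : IsRV Y) (x : α) :
    prob μ X x = ∑ y, prob μ (fun ω => (X ω, Y ω)) (x, y) := by
  classical
  have := prob_comp (μ := μ) (hX.prodMk hY) Prod.fst x
  rw [this, Fintype.sum_prod_type, Finset.sum_eq_single x]
  · simp
  · intro x' _ h; simp [h]
  · simp

lemma prob_eq_sum_left [Fintype α] [Fintype β] [IsFiniteMeasure μ] {X : Ω → α} {Y : Ω → β}
    (hX : IsRV X) (hY : IsRV Y) (y : β) :
    prob μ Y y = ∑ x, prob μ (fun ω => (X ω, Y ω)) (x, y) := by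
  classical
  have := prob_comp (μ := μ) (hX.prodMk hY) Prod.snd y
  rw [this, Fintype.sum_prod_type_right, Finset.sum_eq_single y]
  · simp
  · intro x' _ h; simp [h]
  · simp

lemma sum_prob [Fintype α] [IsProbabilityMeasure μ] {X : Ω → α} (hX : IsRV X) :
    ∑ x, prob μ X x = 1 := by
  classical
  have := prob_comp (μ := μ) hX (fun _ => ()) ()
  simp only [if_true] at this
  rw [← this]
  simp [prob]

lemma prob_triple_drop_mid [Fintype α] [Fintype β] [Fintype γ] [IsFiniteMeasure μ]
    {X : Ω → α} {Y : Ω → β} {V : Ω → γ} (hX : IsRV X) (hY : IsRV Y) (hV : IsRV V)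
    (x : α) (v : γ) :
    prob μ (fun ω => (X ω, V ω)) (x, v) = ∑ y, prob μ (fun ω => (X ω, Y ω, V ω)) (x, y, v) := by
  rw [prob_eq_sum_right (hX.prodMk hV) hY]
  refine Finset.sum_congr rfl fun y _ => ?_
  simp only [prob]
  congr 1
  ext ω
  simp only [Set.mem_preimage, Set.mem_singleton_iff, Prod.mk.injEq]
  tauto

/-- The factors need not be normalised: total mass 1 forces `(∑ f) * (∑ g) = 1`, so they agree with
the marginals up to constants that cancel. -/
lemma mutualInfo_eq_zero_of_factor [Fintype α] [Fintype β] [IsProbabilityMeasure μ]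
    {X : Ω → α} {Y : Ω → β} (hX : IsRV X) (hY : IsRV Y) (f : α → ℝ) (g : β → ℝ)
    (h : ∀ x y, prob μ (fun ω => (X ω, Y ω)) (x, y) = f x * g y) : mutualInfo μ X Y = 0 := by
  have hx : ∀ x, prob μ X x = f x * ∑ y, g y := fun x => by
    rw [prob_eq_sum_right hX hY, Finset.mul_sum]; simp only [h]
  have hy : ∀ y, prob μ Y y = (∑ x, f x) * g y := fun y => by
    rw [prob_eq_sum_left hX hY, Finset.sum_mul]; simp only [h]
  have h1 : (∑ x, f x) * ∑ y, g y = 1 := by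
    rw [Finset.sum_mul, ← sum_prob (μ := μ) hX]; simp only [hx]
  refine Finset.sum_eq_zero fun x _ => Finset.sum_eq_zero fun y _ => ?_
  have : prob μ X x * prob μ Y y = f x * g y := by
    rw [hx, hy]; linear_combination f x * g y * h1
  rw [h, this]
  by_cases h0 : f x * g y = 0
  · simp [h0]
  · simp [div_self h0]

lemma condMutualInfo_eq_zero_of_factor [Fintype α] [Fintype β] [Fintype γ]
    [IsProbabilityMeasure μ] {X : Ω → α} {Y : Ω → β} {V : Ω → γ}
    (hX : IsRV X) (hY : IsRV Y) (hV : IsRV V) (f : α → γ → ℝ) (g : β → γ → ℝ)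
    (h : ∀ x y v, prob μ (fun ω => (X ω, Y ω, V ω)) (x, y, v) = f x v * g y v) :
    condMutualInfo μ X Y V = 0 := by
  have hxv : ∀ x v, prob μ (fun ω => (X ω, V ω)) (x, v) = f x v * ∑ y, g y v := fun x v => by
    rw [prob_triple_drop_mid hX hY hV, Finset.mul_sum]; simp only [h]
  have hyv : ∀ y v, prob μ (fun ω => (Y ω, V ω)) (y, v) = (∑ x, f x v) * g y v := fun y v => by
    rw [prob_eq_sum_left hX (hY.prodMk hV), Finset.sum_mul]; simp only [h]
  have hv : ∀ v, prob μ V v = (∑ x, f x v) * ∑ y, g y v := fun v => by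
    rw [prob_eq_sum_left hX hV, Finset.sum_mul]; simp only [hxv]
  refine Finset.sum_eq_zero fun x _ => Finset.sum_eq_zero fun y _ =>
    Finset.sum_eq_zero fun v _ => ?_
  rw [hxv, hyv, hv, h]
  by_cases h0 : (∑ x, f x v) * (∑ y, g y v) * (f x v * g y v) = 0
  · simp [h0]
  · have : f x v * (∑ y, g y v) * ((∑ x, f x v) * g y v) =
      (∑ x, f x v) * (∑ y, g y v) * (f x v * g y v) := by ring
    rw [this, div_self h0]; simp

lemma condEntropy_eq_zero_of_eq_comp [Fintype α] [Fintype β] {X : Ω → α} {Y : Ω → β}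
    (f : β → α) (h : ∀ ω, X ω = f (Y ω)) : condEntropy μ X Y = 0 := by
  rw [condEntropy, neg_eq_zero]
  refine Finset.sum_eq_zero fun x _ => Finset.sum_eq_zero fun y _ => ?_
  by_cases hxy : x = f y
  · have : prob μ (fun ω => (X ω, Y ω)) (x, y) = prob μ Y y := by
      simp only [prob]
      congr 1
      ext ω
      simp only [Set.mem_preimage, Set.mem_singleton_iff, Prod.mk.injEq, h, hxy]
      exact ⟨fun h => h.2, fun h => ⟨by rw [h], h⟩⟩
    rw [this]
    by_cases h0 : prob μ Y y = 0
    · simp [h0]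
    · simp [div_self h0]
  · have : prob μ (fun ω => (X ω, Y ω)) (x, y) = 0 := by
      have : (fun ω => (X ω, Y ω)) ⁻¹' {(x, y)} = ∅ := by
        ext ω
        simp only [Set.mem_preimage, Set.mem_singleton_iff, Prod.mk.injEq, h,
          Set.mem_empty_iff_false, iff_false, not_and]
        rintro rfl rfl
        exact hxy rfl
      simp [prob, this]
    simp [this]

/-- The termwise Gibbs inequality with its equality case, from `log x ≤ x - 1`, strict for `x ≠ 1`.
The condition `hab` is absolute continuity; without it the convention `a / 0 = 0` would make the
bound false. -/
lemma sub_le_mul_log_div {a b : ℝ} (ha : 0 ≤ a) (hb : 0 ≤ b) (hab : b = 0 → a = 0) :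
    a - b ≤ a * Real.log (a / b) ∧ (a * Real.log (a / b) = a - b → a = b) := by
  rcases ha.eq_or_lt with rfl | ha
  · simp [hb, eq_comm]
  have hb : 0 < b := hb.lt_of_ne fun h => ha.ne' (hab h.symm)
  have hlog : Real.log (a / b) = - Real.log (b / a) := by rw [← Real.log_inv, inv_div]
  have hm : a * (b / a - 1) = b - a := by field_simp
  constructor
  · have := mul_le_mul_of_nonneg_left (Real.log_le_sub_one_of_pos (div_pos hb ha)) ha.le
    rw [hlog]; linarith
  · intro h
    by_contra hne
    have h1 : b / a ≠ 1 := fun h => hne (((div_eq_one_iff_eq ha.ne').1 h).symm)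
    have := mul_lt_mul_of_pos_left (Real.log_lt_sub_one_of_pos (div_pos hb ha) h1) ha
    rw [hlog] at h; linarith

/-- Vanishing conditional mutual information means conditional independence. -/
lemma condIndep_of_condMutualInfo_eq_zero [Fintype α] [Fintype β] [Fintype γ]
    [IsProbabilityMeasure μ] {X : Ω → α} {Y : Ω → β} {V : Ω → γ}
    (hX : IsRV X) (hY : IsRV Y) (hV : IsRV V) (h : condMutualInfo μ X Y V = 0)
    (x : α) (y : β) (v : γ) :
    prob μ (fun ω => (X ω, Y ω, V ω)) (x, y, v) =
      prob μ (fun ω => (X ω, V ω)) (x, v) *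
        (prob μ (fun ω => (Y ω, V ω)) (y, v) / prob μ V v) := by
  set p : α × β × γ → ℝ := prob μ (fun ω => (X ω, Y ω, V ω)) with hp
  set r : α × γ → ℝ := prob μ (fun ω => (X ω, V ω)) with hr
  set s : β × γ → ℝ := prob μ (fun ω => (Y ω, V ω)) with hs
  set t : γ → ℝ := prob μ V with ht
  have hp0 : ∀ z, 0 ≤ p z := fun z => prob_nonneg _ _
  have hr0 : ∀ z, 0 ≤ r z := fun z => prob_nonneg _ _
  have hs0 : ∀ z, 0 ≤ s z := fun z => prob_nonneg _ _
  have ht0 : ∀ z, 0 ≤ t z := fun z => prob_nonneg _ _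
  have hrp : ∀ x v, r (x, v) = ∑ y, p (x, y, v) := fun x v => prob_triple_drop_mid hX hY hV x v
  have hsp : ∀ y v, s (y, v) = ∑ x, p (x, y, v) := fun y v =>
    prob_eq_sum_left hX (hY.prodMk hV) (y, v)
  have htr : ∀ v, t v = ∑ x, r (x, v) := fun v => prob_eq_sum_left hX hV v
  have hts : ∀ v, t v = ∑ y, s (y, v) := fun v => prob_eq_sum_left hY hV v
  have hpr : ∀ x y v, p (x, y, v) ≤ r (x, v) := fun x y v => by
    rw [hrp]
    exact Finset.single_le_sum (f := fun y => p (x, y, v)) (fun _ _ => hp0 _) (Finset.mem_univ y)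
  have hps : ∀ x y v, p (x, y, v) ≤ s (y, v) := fun x y v => by
    rw [hsp]
    exact Finset.single_le_sum (f := fun x => p (x, y, v)) (fun _ _ => hp0 _) (Finset.mem_univ x)
  have hrt : ∀ x v, r (x, v) ≤ t v := fun x v => by
    rw [htr]
    exact Finset.single_le_sum (f := fun x => r (x, v)) (fun _ _ => hr0 _) (Finset.mem_univ x)
  have hb0 : ∀ x y v, 0 ≤ r (x, v) * (s (y, v) / t v) := fun x y v =>
    mul_nonneg (hr0 _) (div_nonneg (hs0 _) (ht0 _))
  have key : ∀ x y v, p (x, y, v) - r (x, v) * (s (y, v) / t v) ≤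
      p (x, y, v) * Real.log (t v * p (x, y, v) / (r (x, v) * s (y, v))) ∧
      (p (x, y, v) * Real.log (t v * p (x, y, v) / (r (x, v) * s (y, v))) =
        p (x, y, v) - r (x, v) * (s (y, v) / t v) →
          p (x, y, v) = r (x, v) * (s (y, v) / t v)) := by
    intro x y v
    have harg : t v * p (x, y, v) / (r (x, v) * s (y, v)) =
        p (x, y, v) / (r (x, v) * (s (y, v) / t v)) := by
      rw [← mul_div_assoc, div_div_eq_mul_div, mul_comm (t v)]
    rw [harg]
    refine sub_le_mul_log_div (hp0 _) (hb0 x y v) fun h0 => ?_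
    rcases mul_eq_zero.1 h0 with h0 | h0
    · exact le_antisymm (h0 ▸ hpr x y v) (hp0 _)
    rcases div_eq_zero_iff.1 h0 with h0 | h0
    · exact le_antisymm (h0 ▸ hps x y v) (hp0 _)
    · exact le_antisymm (h0 ▸ (hpr x y v).trans (hrt x v)) (hp0 _)
  -- Both distributions have the same total mass, so the information equals the sum of the
  -- nonnegative defects in `key`. If it vanishes, each defect vanishes and the equality case
  -- applies.
  have hsum : ∑ x, ∑ y, ∑ v, (p (x, y, v) - r (x, v) * (s (y, v) / t v)) = 0 := by
    refine Finset.sum_eq_zero fun x _ => ?_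
    rw [Finset.sum_comm]
    refine Finset.sum_eq_zero fun v _ => ?_
    rw [Finset.sum_sub_distrib, ← hrp, ← Finset.mul_sum, ← Finset.sum_div, ← hts]
    by_cases h0 : t v = 0
    · have : r (x, v) = 0 := le_antisymm (h0 ▸ hrt x v) (hr0 _)
      simp [this]
    · simp [div_self h0]
  have hz : ∑ z : α × β × γ, (p (z.1, z.2.1, z.2.2) * Real.log (t z.2.2 * p (z.1, z.2.1, z.2.2) /
      (r (z.1, z.2.2) * s (z.2.1, z.2.2))) -
        (p (z.1, z.2.1, z.2.2) - r (z.1, z.2.2) * (s (z.2.1, z.2.2) / t z.2.2))) = 0 := by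
    rw [Finset.sum_sub_distrib]
    simp only [Fintype.sum_prod_type]
    rw [hsum, sub_zero]
    exact h
  have := (Finset.sum_eq_zero_iff_of_nonneg
    fun z _ => sub_nonneg.2 (key z.1 z.2.1 z.2.2).1).1 hz (x, y, v) (Finset.mem_univ _)
  exact (key x y v).2 (sub_eq_zero.1 this)

/-- If `Y` is conditionally independent of `M` given `V`, and for each value `y` of `Y` the
pair `(g M y, V)` is independent of `W = π M`, then `g M Y` carries no information on `W`. -/
lemma mutualInfo_eq_zero_of_condMutualInfo_eq_zero [Fintype α] [Fintype β] [Fintype γ]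
    [Fintype δ] [Fintype ε] [IsProbabilityMeasure μ] {M : Ω → α} {Y : Ω → β} {V : Ω → γ}
    (hM : IsRV M) (hY : IsRV Y) (hV : IsRV V) (h : condMutualInfo μ M Y V = 0)
    (π : α → δ) (g : α → β → ε) (f : δ → ℝ) (φ : β → ε → γ → ℝ)
    (hφ : ∀ y w r v, prob μ (fun ω => (π (M ω), g (M ω) y, V ω)) (w, r, v) = f w * φ y r v) :
    mutualInfo μ (fun ω => π (M ω)) (fun ω => g (M ω) (Y ω)) = 0 := by
  classical
  refine mutualInfo_eq_zero_of_factor (hM.comp π)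
    ((hM.prodMk hY).comp fun z : α × β => g z.1 z.2) f
    (fun r => ∑ y, ∑ v, φ y r v * (prob μ (fun ω => (Y ω, V ω)) (y, v) / prob μ V v)) ?_
  intro w r
  -- With `y` and `v` fixed, conditional independence replaces `p(m,y,v)` by `p(m,v) p(y,v) / p(v)`;
  -- summing over `m` then involves `g` only at the frozen value `y`, where `hφ` applies.
  rw [prob_comp (hM.prodMk (hY.prodMk hV)) (fun z : α × β × γ => (π z.1, g z.1 z.2.1)) (w, r)]
  simp only [Fintype.sum_prod_type]
  rw [Finset.sum_comm, Finset.mul_sum]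
  refine Finset.sum_congr rfl fun y _ => ?_
  rw [Finset.sum_comm, Finset.mul_sum]
  refine Finset.sum_congr rfl fun v _ => ?_
  rw [← mul_assoc, ← hφ,
    prob_comp (hM.prodMk hV) (fun z : α × γ => (π z.1, g z.1 y, z.2)) (w, r, v),
    Fintype.sum_prod_type, Finset.sum_mul]
  refine Finset.sum_congr rfl fun m _ => ?_
  rw [Finset.sum_eq_single v (fun v' _ hv' => by simp [hv']) (by simp)]
  simp only [Prod.mk.injEq, and_true]
  split_ifs with h0
  · exact condIndep_of_condMutualInfo_eq_zero hM hY hV h m y v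
  · simp

end Information

/-! ### Ramp secret sharing by polynomial evaluation. -/

section RampSharing

variable {𝔽 : Type*} [Field 𝔽]

/-- The value at `x` of the polynomial with `L` data coefficients followed by `I` masking
coefficients. -/
def share {L I : ℕ} (x : 𝔽) : (Fin L ⊕ Fin I → 𝔽) →ₗ[𝔽] 𝔽 where
  toFun c := ∑ e, x ^ (finSumFinEquiv e : ℕ) * c e
  map_add' c c' := by simp only [Pi.add_apply, mul_add, Finset.sum_add_distrib]
  map_smul' r c := by
    simp only [Pi.smul_apply, smul_eq_mul, RingHom.id_apply, Finset.mul_sum]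
    exact Finset.sum_congr rfl fun e _ => by ring

lemma share_apply {L I : ℕ} (x : 𝔽) (c : Fin L ⊕ Fin I → 𝔽) :
    share x c = ∑ e, x ^ (finSumFinEquiv e : ℕ) * c e := rfl

/-- Vandermonde: a polynomial with `L + I` coefficients and as many distinct roots is zero. -/
lemma eq_zero_of_share_eq_zero {ι : Type*} {L I : ℕ} {α : ι → 𝔽} (hα : Function.Injective α)
    (T : Finset ι) (hT : L + I ≤ T.card) (c : Fin L ⊕ Fin I → 𝔽)
    (h : ∀ i ∈ T, share (α i) c = 0) : c = 0 := by
  classical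
  obtain ⟨T', hT', hcard⟩ := Finset.exists_subset_card_eq hT
  let e : Fin (L + I) ≃ T' := (Fintype.equivFinOfCardEq (by simpa using hcard)).symm
  have := Matrix.eq_zero_of_forall_index_sum_pow_mul_eq_zero
    (f := fun i => α (e i)) (v := fun i => c (finSumFinEquiv.symm i))
    (fun i j hij => e.injective (Subtype.ext (hα hij))) (fun j => by
      have := h (e j) (hT' (e j).2)
      rw [share_apply, ← Equiv.sum_comp finSumFinEquiv.symm] at this
      simpa using this)
  ext i
  simpa using congrFun this (finSumFinEquiv i)

/-- The masking part contributes `x ^ L * g x` with `deg g < I`. Take for `g` the interpolant of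
minus the data part divided by `x ^ L`; this division is why the evaluation points must be nonzero.
-/
lemma exists_share_eq_zero {ι : Type*} {L I : ℕ} {α : ι → 𝔽} (hα : Function.Injective α)
    (hα0 : ∀ i, α i ≠ 0) (T : Finset ι) (hT : T.card ≤ I) (w : Fin L → 𝔽) :
    ∃ r : Fin I → 𝔽, ∀ i ∈ T, share (α i) (Sum.elim w r) = 0 := by
  classical
  let g := Lagrange.interpolate T α fun i => - ((α i ^ L)⁻¹ * ∑ l : Fin L, α i ^ (l : ℕ) * w l)
  have hg : g.degree < I := lt_of_lt_of_le
    (Lagrange.degree_interpolate_lt _ hα.injOn) (by exact_mod_cast hT)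
  refine ⟨fun i => g.coeff i, fun i hi => ?_⟩
  have he : g.eval (α i) = - ((α i ^ L)⁻¹ * ∑ l : Fin L, α i ^ (l : ℕ) * w l) :=
    Lagrange.eval_interpolate_at_node _ hα.injOn hi
  have hI : g.eval (α i) = ∑ j : Fin I, g.coeff j * α i ^ (j : ℕ) := by
    by_cases hg0 : g = 0
    · simp [hg0]
    rw [Polynomial.eval_eq_sum_range' ((Polynomial.natDegree_lt_iff_degree_lt hg0).2 hg),
      Finset.sum_range]
  have hm : ∑ j : Fin I, α i ^ (L + (j : ℕ)) * g.coeff j = α i ^ L * g.eval (α i) := by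
    rw [hI, Finset.mul_sum]
    exact Finset.sum_congr rfl fun j _ => by ring
  rw [share_apply, Fintype.sum_sum_type]
  simp only [Sum.elim_inl, Sum.elim_inr, finSumFinEquiv_apply_left, finSumFinEquiv_apply_right,
    Fin.val_castAdd, Fin.val_natAdd]
  rw [hm, he, mul_neg, ← mul_assoc, mul_inv_cancel₀ (pow_ne_zero _ (hα0 i)), one_mul,
    add_neg_cancel]

end RampSharing

/-! ### The linear delivery code of the array, at a single position of the packets. -/

section Coding

variable {𝔽 : Type*} [Field 𝔽] {N K F S L I : ℕ}

/-- Indices of the key symbols: the masking coefficients of the file packets, and all the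
coefficients of the keys that protect the signals. -/
abbrev KeyIndex (N F S L I : ℕ) := (Fin N × Fin F) × Fin I ⊕ Fin S × (Fin L ⊕ Fin I)

/-- Indices of the shares held by a server. -/
abbrev Slot (N F S : ℕ) := Fin N × Fin F ⊕ Fin S

/-- The coefficients of the polynomials that are shared among the servers. -/
def slotCoeff (w : Fin N → Fin (L * F) → 𝔽) (κ : KeyIndex N F S L I → 𝔽) :
    Slot N F S → Fin L ⊕ Fin I → 𝔽
  | Sum.inl nj => Sum.elim (fun l => w nj.1 (finProdFinEquiv (l, nj.2))) fun i => κ (Sum.inl (nj, i))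
  | Sum.inr s => fun e => κ (Sum.inr (s, e))

lemma slotCoeff_add (w w' : Fin N → Fin (L * F) → 𝔽) (κ κ' : KeyIndex N F S L I → 𝔽)
    (i : Slot N F S) :
    slotCoeff (w + w') (κ + κ') i = slotCoeff w κ i + slotCoeff w' κ' i := by
  rcases i with nj | s <;> ext (l | i) <;> simp [slotCoeff]

lemma slotCoeff_smul (r : 𝔽) (w : Fin N → Fin (L * F) → 𝔽) (κ : KeyIndex N F S L I → 𝔽)
    (i : Slot N F S) : slotCoeff (r • w) (r • κ) i = r • slotCoeff w κ i := by
  rcases i with nj | s <;> ext (l | i) <;> simp [slotCoeff]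

/-- The part of the signal for the ordinary symbol `s` that serves the users. -/
def multicast {M : Type*} [AddCommGroup M] [Module 𝔽 M] (a : Fin F → Fin K → Option (Fin S))
    (q : Fin K → Fin N → 𝔽) (y : Fin N × Fin F → M) (s : Fin S) : M :=
  ∑ j, ∑ k, if a j k = some s then ∑ n, q k n • y (n, j) else 0

/-- The signal for the ordinary symbol `s`. -/
def combine {M : Type*} [AddCommGroup M] [Module 𝔽 M] (a : Fin F → Fin K → Option (Fin S))
    (q : Fin K → Fin N → 𝔽) (y : Slot N F S → M) (s : Fin S) : M :=
  y (Sum.inr s) + multicast a q (fun nj => y (Sum.inl nj)) s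

variable (a : Fin F → Fin K → Option (Fin S)) (q : Fin K → Fin N → 𝔽)

lemma map_multicast {M M' : Type*} [AddCommGroup M] [Module 𝔽 M] [AddCommGroup M'] [Module 𝔽 M']
    (f : M →ₗ[𝔽] M') (y : Fin N × Fin F → M) (s : Fin S) :
    f (multicast a q y s) = multicast a q (fun i => f (y i)) s := by
  simp only [multicast, map_sum, map_smul, apply_ite f, map_zero]

/-- Applied to `share x`, this says that a server combining its shares obtains its share of the
combined polynomial. -/
lemma map_combine {M M' : Type*} [AddCommGroup M] [Module 𝔽 M] [AddCommGroup M'] [Module 𝔽 M']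
    (f : M →ₗ[𝔽] M') (y : Slot N F S → M) (s : Fin S) :
    f (combine a q y s) = combine a q (fun i => f (y i)) s := by
  simp only [combine, map_add, map_multicast]

lemma multicast_zero {M : Type*} [AddCommGroup M] [Module 𝔽 M] (s : Fin S) :
    multicast a q (fun _ => (0 : M)) s = 0 := by
  simp [multicast]

lemma combine_add {M : Type*} [AddCommGroup M] [Module 𝔽 M] (y y' : Slot N F S → M) (s : Fin S) :
    combine a q (fun i => y i + y' i) s = combine a q y s + combine a q y' s := by
  simp only [combine, multicast, smul_add, Finset.sum_add_distrib, ite_add_zero]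
  abel

lemma combine_eq_sum (y : Slot N F S → 𝔽) (s : Fin S) :
    combine a q y s =
      ∑ i, combine a q (fun i => (Pi.single i 1 : Slot N F S → 𝔽)) s i * y i := by
  have := map_combine a q (Fintype.linearCombination 𝔽 y)
    (fun i => (Pi.single i 1 : Slot N F S → 𝔽)) s
  simp only [Fintype.linearCombination_apply_single, one_smul] at this
  rw [← this, Fintype.linearCombination_apply]
  rfl

/-- The translation of the keys that hides the file packets `w` from the servers in `T` and from
everyone who sees the signals. -/
lemma exists_masking_keys {ι : Type*} {α : ι → 𝔽} (hα : Function.Injective α)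
    (hα0 : ∀ i, α i ≠ 0) (T : Finset ι) (hT : T.card ≤ I) (w : Fin N → Fin (L * F) → 𝔽) :
    ∃ κ : KeyIndex N F S L I → 𝔽,
      (∀ h ∈ T, ∀ i, share (α h) (slotCoeff w κ i) = 0) ∧
        ∀ s, combine a q (slotCoeff w κ) s = 0 := by
  choose r hr using fun nj : Fin N × Fin F => exists_share_eq_zero (I := I) hα hα0 T hT
    fun l => w nj.1 (finProdFinEquiv (l, nj.2))
  let c : Fin N × Fin F → Fin L ⊕ Fin I → 𝔽 := fun nj =>
    Sum.elim (fun l => w nj.1 (finProdFinEquiv (l, nj.2))) (r nj)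
  -- The signal keys are chosen to cancel the multicast part, so all combinations vanish. Their
  -- shares on `T` vanish too, because those of the `c nj` do.
  refine ⟨Sum.elim (fun x => r x.1 x.2) fun x => - multicast a q c x.1 x.2, ?_, ?_⟩
  · rintro h hh (nj | s)
    · exact hr nj h hh
    · have : slotCoeff w (Sum.elim (fun x => r x.1 x.2) fun x => - multicast a q c x.1 x.2)
          (Sum.inr s) = - multicast a q c s := rfl
      rw [this, map_neg, map_multicast]
      have : (fun i => share (α h) (c i)) = fun _ => 0 := funext fun nj => hr nj h hh
      rw [this, multicast_zero, neg_zero]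
  · intro s
    exact neg_add_cancel (multicast a q c s)

/-- Indices of the packets cached by user `k`. -/
abbrev CacheIndex (N L : ℕ) (a : Fin F → Fin K → Option (Fin S)) (k : Fin K) :=
  {j // a j k = none} × Fin N × Fin L ⊕ {j // ¬ a j k = none} × Fin L

lemma card_cacheIndex {Z : ℕ} (ha : IsPDA Z a) (k : Fin K) :
    Fintype.card (CacheIndex N L a k) = Z * (N * L) + (F - Z) * L := by
  have h : Fintype.card {j // a j k = none} = Z := by
    rw [Fintype.card_subtype]; exact ha.stars k
  have h' : Fintype.card {j // ¬ a j k = none} = F - Z := by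
    rw [Fintype.card_subtype_compl, h, Fintype.card_fin]
  simp [h, h']

/-- Cached symbols: uncoded file symbols where the array has a star, and elsewhere the requested
file symbols masked by the key of the signal. -/
def cacheSymbol (k : Fin K) (p : Fin N → 𝔽) (w : Fin N → Fin (L * F) → 𝔽)
    (κ : KeyIndex N F S L I → 𝔽) : CacheIndex N L a k → 𝔽
  | Sum.inl x => w x.2.1 (finProdFinEquiv (x.2.2, x.1.1))
  | Sum.inr x => (∑ s, if a x.1 k = some s then κ (Sum.inr (s, Sum.inl x.2)) else 0) +
      ∑ n, p n * w n (finProdFinEquiv (x.2, x.1.1))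

lemma cacheSymbol_add (k : Fin K) (p : Fin N → 𝔽) (w w' : Fin N → Fin (L * F) → 𝔽)
    (κ κ' : KeyIndex N F S L I → 𝔽) (i : CacheIndex N L a k) :
    cacheSymbol a k p (w + w') (κ + κ') i = cacheSymbol a k p w κ i + cacheSymbol a k p w' κ' i := by
  rcases i with i | i
  · simp [cacheSymbol]
  · simp only [cacheSymbol, Pi.add_apply, mul_add, Finset.sum_add_distrib, ite_add_zero]
    ring

lemma cacheSymbol_smul (k : Fin K) (p : Fin N → 𝔽) (r : 𝔽) (w : Fin N → Fin (L * F) → 𝔽)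
    (κ : KeyIndex N F S L I → 𝔽) (i : CacheIndex N L a k) :
    cacheSymbol a k p (r • w) (r • κ) i = r * cacheSymbol a k p w κ i := by
  rcases i with i | i
  · simp [cacheSymbol]
  · simp only [cacheSymbol, Pi.smul_apply, smul_eq_mul, mul_add, Finset.mul_sum, mul_ite, mul_zero]
    congr 1
    exact Finset.sum_congr rfl fun n _ => by ring

variable {a} in
/-- If the signals and the cache of user `k` vanish, then so does the requested combination. -/
lemma demanded_eq_zero {Z : ℕ} (ha : IsPDA Z a) (k : Fin K) (e p : Fin N → 𝔽)
    (hq : q k = e + p) (w : Fin N → Fin (L * F) → 𝔽) (κ : KeyIndex N F S L I → 𝔽)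
    (hX : ∀ s, combine a q (slotCoeff w κ) s = 0) (hC : ∀ i, cacheSymbol a k p w κ i = 0)
    (l : Fin L) (j : Fin F) : ∑ n, e n * w n (finProdFinEquiv (l, j)) = 0 := by
  rcases hj : a j k with _ | s
  · have : ∀ n, w n (finProdFinEquiv (l, j)) = 0 := fun n => hC (Sum.inl (⟨j, hj⟩, n, l))
    simp [this]
  have h1 := hC (Sum.inr (⟨j, by simp [hj]⟩, l))
  simp only [cacheSymbol, hj, Option.some.injEq, Finset.sum_ite_eq, Finset.mem_univ,
    if_true] at h1
  have h2 := congrFun (hX s) (Sum.inl l)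
  simp only [combine, multicast, Pi.add_apply, Pi.zero_apply, Finset.sum_apply] at h2
  -- Only the cell `(j, k)` survives: any other cell `(j', k')` holding `s` forces a star at `(j',
  -- k)`, so user `k` caches row `j'` uncoded and its packets are zero.
  have h3 : ∀ j' k', (if a j' k' = some s then
      ∑ n, q k' n • slotCoeff w κ (Sum.inl (n, j')) else 0) (Sum.inl l) =
      if j' = j then if k' = k then ∑ n, q k n * w n (finProdFinEquiv (l, j)) else 0 else 0 := by
    intro j' k'
    by_cases hjk : (j, k) = (j', k')
    · obtain ⟨rfl, rfl⟩ := Prod.mk.inj hjk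
      simp [hj, slotCoeff, Finset.sum_apply]
    · have hne : ¬ (j' = j ∧ k' = k) := fun h => hjk (by rw [h.1, h.2])
      rw [← ite_and, if_neg hne]
      split_ifs with hs
      · have hstar := (ha.distinct j k j' k' s hjk hj hs).2.2.2
        have : ∀ n, w n (finProdFinEquiv (l, j')) = 0 := fun n => hC (Sum.inl (⟨j', hstar⟩, n, l))
        simp [slotCoeff, this, Finset.sum_apply]
      · rfl
  simp only [h3, Finset.sum_ite_eq', Finset.mem_univ, if_true, Finset.sum_ite_irrel,
    Finset.sum_const_zero] at h2
  simp only [slotCoeff, hq, Pi.add_apply, add_mul, Finset.sum_add_distrib] at h2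
  -- Here `h2` says that key plus `(e + p)` times the packets is zero, and `h1` that key plus `p`
  -- times the packets is zero.
  linear_combination h2 - h1

end Coding

/-! ### Coefficients of linear maps, translation of uniform keys, error correction. -/

lemma exists_coeff_of_linear {𝔽 : Type*} [Field 𝔽] {N m v : ℕ}
    (φ : (Fin N → Fin m → 𝔽) → (Fin v → 𝔽) → 𝔽)
    (hadd : ∀ w w' κ κ', φ (w + w') (κ + κ') = φ w κ + φ w' κ')
    (hsmul : ∀ (r : 𝔽) w κ, φ (r • w) (r • κ) = r * φ w κ) :
    ∃ (c : Fin N → Fin m → 𝔽) (d : Fin v → 𝔽), ∀ w κ,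
      φ w κ = (∑ n, ∑ j, c n j * w n j) + ∑ i, d i * κ i := by
  let f : ((Fin N × Fin m) ⊕ Fin v → 𝔽) →ₗ[𝔽] 𝔽 :=
    { toFun := fun x => φ (fun n j => x (Sum.inl (n, j))) fun i => x (Sum.inr i)
      map_add' := fun x y => hadd _ _ _ _
      map_smul' := fun r x => hsmul _ _ _ }
  refine ⟨fun n j => f (fun i => if Sum.inl (n, j) = i then 1 else 0),
    fun i => f (fun i' => if Sum.inr i = i' then 1 else 0), fun w κ => ?_⟩
  have := f.pi_apply_eq_sum_univ (Sum.elim (fun x => w x.1 x.2) κ)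
  simp only [Fintype.sum_sum_type, Fintype.sum_prod_type, Sum.elim_inl, Sum.elim_inr,
    smul_eq_mul] at this
  simp only [mul_comm (f _)]
  exact this

/-- The joint law does not depend on the value of `U`, so the substitution `x ↦ x + c` turns the
fibre count at `w` into the one at the reference value `w₀`; up to the factor `f w`, the law of the
observation is the same for all `w`. -/
lemma exists_factor_of_translation {Ω 𝓦 𝓔 𝓤 γ : Type*} [MeasurableSpace Ω] {μ : Measure Ω}
    [IsFiniteMeasure μ] [Fintype 𝓦] [Fintype 𝓔] [Fintype 𝓤] [AddGroup 𝓤]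
    {W : Ω → 𝓦} {E : Ω → 𝓔} {U : Ω → 𝓤} (hW : IsRV W) (hE : IsRV E) (hU : IsRV U)
    (f : 𝓦 → ℝ) (ψ : 𝓔 → ℝ)
    (hprob : ∀ w e x, prob μ (fun ω => (W ω, E ω, U ω)) (w, e, x) = f w * ψ e)
    (w₀ : 𝓦) (G : 𝓦 → 𝓔 → 𝓤 → γ) (hG : ∀ w e, ∃ c, ∀ x, G w e (x + c) = G w₀ e x) :
    ∃ φ : γ → ℝ, ∀ w g,
      prob μ (fun ω => (W ω, G (W ω) (E ω) (U ω))) (w, g) = f w * φ g := by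
  classical
  refine ⟨fun g => ∑ e, ∑ x, if G w₀ e x = g then ψ e else 0, fun w g => ?_⟩
  rw [prob_comp (hW.prodMk (hE.prodMk hU))
    (fun z : 𝓦 × 𝓔 × 𝓤 => (z.1, G z.1 z.2.1 z.2.2)) (w, g)]
  simp only [Fintype.sum_prod_type]
  rw [Finset.sum_eq_single w (fun w' _ h => by simp [h]) (by simp), Finset.mul_sum]
  refine Finset.sum_congr rfl fun e _ => ?_
  obtain ⟨c, hc⟩ := hG w e
  rw [← Equiv.sum_comp (Equiv.addRight c), Finset.mul_sum]
  refine Finset.sum_congr rfl fun x _ => ?_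
  simp [hc, hprob]

/-- A code whose codewords agree in all but `2 A` positions of `𝓙` only if they carry the same
value can be decoded from `𝓙` in spite of `A` errors. -/
lemma exists_error_correcting_decoder {H : ℕ} {β : Fin H → Type u} {ι : Sort*} {γ : Type*}
    [Nonempty γ] (𝓙 : Finset (Fin H)) (A : ℕ) (x : ι → ∀ h, β h) (v : ι → γ)
    (hx : ∀ i i', ∀ T ⊆ 𝓙, 𝓙.card ≤ T.card + 2 * A → (∀ h ∈ T, x i h = x i' h) → v i = v i') :
    ∃ dec : (∀ h : 𝓙, β h) → γ, ∀ 𝓐 : Finset (Fin H), 𝓐.card ≤ A → ∀ i y,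
      dec (𝓙.restrict (Scheme.corrupt 𝓐 (x i) y)) = v i := by
  classical
  let good : (∀ h : 𝓙, β h) → ι → Prop := fun r i =>
    ∃ 𝓐 : Finset (Fin H), 𝓐.card ≤ A ∧ ∃ y, 𝓙.restrict (Scheme.corrupt 𝓐 (x i) y) = r
  -- The decoder picks any index explaining the received word with at most `A` errors. It and the
  -- true index agree on `𝓙` outside two sets of size at most `A`. The arbitrary default is used
  -- only on words that no index explains.
  refine ⟨fun r => if h : ∃ i, good r i then v h.choose else Classical.arbitrary γ,
    fun 𝓐 h𝓐 i y => ?_⟩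
  have hex : ∃ i', good (𝓙.restrict (Scheme.corrupt 𝓐 (x i) y)) i' := ⟨i, 𝓐, h𝓐, y, rfl⟩
  dsimp only
  rw [dif_pos hex]
  obtain ⟨𝓐', h𝓐', y', hy'⟩ := hex.choose_spec
  refine hx _ _ (𝓙 \ (𝓐 ∪ 𝓐')) Finset.sdiff_subset ?_ fun h hh => ?_
  · have h1 := Finset.le_card_sdiff (𝓐 ∪ 𝓐') 𝓙
    have h2 := Finset.card_union_le 𝓐 𝓐'
    omega
  · simp only [Finset.mem_sdiff, Finset.mem_union, not_or] at hh
    have := congrFun hy' ⟨h, hh.1⟩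
    simpa [Scheme.corrupt, hh.2.1, hh.2.2] using this

/-! ### The scheme on whole packets, its robustness and its packetization. -/

section LFRScheme

variable {𝔽 : Type u} [Field 𝔽] {N K H F S Z L I b : ℕ}

/-- The symbols at position `t` of the packets of the files. -/
def fileLayer (w : Fin N → Fin (L * F * b) → 𝔽) (t : Fin b) : Fin N → Fin (L * F) → 𝔽 :=
  fun n m => w n (finProdFinEquiv (m, t))

/-- The symbols at position `t` of the key packets. -/
def keyLayer {κ : Type*} (x : κ → Fin b → 𝔽) (t : Fin b) : κ → 𝔽 := fun v => x v t

/-- The content of the server with evaluation point `x`. -/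
noncomputable def serverStore (x : 𝔽) (w : Fin N → Fin (L * F * b) → 𝔽)
    (u : KeyIndex N F S L I → Fin b → 𝔽) : Fin (Fintype.card (Slot N F S) * b) → 𝔽 := fun i =>
  share x (slotCoeff (fileLayer w (finProdFinEquiv.symm i).2)
    (keyLayer u (finProdFinEquiv.symm i).2)
    ((Fintype.equivFin (Slot N F S)).symm (finProdFinEquiv.symm i).1))

/-- The cache of user `k` with private randomness `p`. -/
noncomputable def userCache {a : Fin F → Fin K → Option (Fin S)} (ha : IsPDA Z a) (k : Fin K)
    (p : Fin N → 𝔽) (u : KeyIndex N F S L I → Fin b → 𝔽) (w : Fin N → Fin (L * F * b) → 𝔽) :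
    Fin ((Z * (N * L) + (F - Z) * L) * b) → 𝔽 := fun i =>
  cacheSymbol a k p (fileLayer w (finProdFinEquiv.symm i).2)
    (keyLayer u (finProdFinEquiv.symm i).2)
    ((Fintype.equivFinOfCardEq (card_cacheIndex a ha k)).symm (finProdFinEquiv.symm i).1)

/-- The signal of a server with content `z` that receives the queries `q`: all the queries,
followed by one packet for each ordinary symbol of the array. -/
noncomputable def serverSignal (a : Fin F → Fin K → Option (Fin S))
    (z : Fin (Fintype.card (Slot N F S) * b) → 𝔽) (q : Fin K → Fin N → 𝔽) :
    Fin (K * N + S * b) → 𝔽 := fun i =>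
  Sum.elim (fun i : Fin (K * N) => q (finProdFinEquiv.symm i).1 (finProdFinEquiv.symm i).2)
    (fun i : Fin (S * b) => combine a q
      (fun v => z (finProdFinEquiv (Fintype.equivFin (Slot N F S) v, (finProdFinEquiv.symm i).2)))
      (finProdFinEquiv.symm i).1) (finSumFinEquiv.symm i)

lemma serverStore_apply (x : 𝔽) (w : Fin N → Fin (L * F * b) → 𝔽)
    (u : KeyIndex N F S L I → Fin b → 𝔽) (i : Slot N F S) (t : Fin b) :
    serverStore x w u (finProdFinEquiv (Fintype.equivFin _ i, t)) =
      share x (slotCoeff (fileLayer w t) (keyLayer u t) i) := by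
  simp only [serverStore, Equiv.symm_apply_apply]

lemma serverStore_add (x : 𝔽) (w w' : Fin N → Fin (L * F * b) → 𝔽)
    (u u' : KeyIndex N F S L I → Fin b → 𝔽) :
    serverStore x (w + w') (u + u') = serverStore x w u + serverStore x w' u' := by
  ext i
  exact (congrArg (share x) (slotCoeff_add _ _ _ _ _)).trans (map_add _ _ _)

variable {a : Fin F → Fin K → Option (Fin S)} (ha : IsPDA Z a)

lemma userCache_apply (k : Fin K) (p : Fin N → 𝔽) (w : Fin N → Fin (L * F * b) → 𝔽)
    (u : KeyIndex N F S L I → Fin b → 𝔽) (i : CacheIndex N L a k) (t : Fin b) :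
    userCache ha k p u w
        (finProdFinEquiv (Fintype.equivFinOfCardEq (card_cacheIndex a ha k) i, t)) =
      cacheSymbol a k p (fileLayer w t) (keyLayer u t) i := by
  simp only [userCache, Equiv.symm_apply_apply]

lemma serverSignal_header (z : Fin (Fintype.card (Slot N F S) * b) → 𝔽) (q : Fin K → Fin N → 𝔽)
    (k : Fin K) (n : Fin N) :
    serverSignal a z q (finSumFinEquiv (Sum.inl (finProdFinEquiv (k, n)))) = q k n := by
  simp only [serverSignal, Equiv.symm_apply_apply, Sum.elim_inl]

lemma serverSignal_apply (z : Fin (Fintype.card (Slot N F S) * b) → 𝔽) (q : Fin K → Fin N → 𝔽)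
    (s : Fin S) (t : Fin b) :
    serverSignal a z q (finSumFinEquiv (Sum.inr (finProdFinEquiv (s, t)))) =
      combine a q (fun v => z (finProdFinEquiv (Fintype.equivFin (Slot N F S) v, t))) s := by
  simp only [serverSignal, Equiv.symm_apply_apply, Sum.elim_inr]

lemma serverSignal_serverStore_apply (x : 𝔽) (w : Fin N → Fin (L * F * b) → 𝔽)
    (u : KeyIndex N F S L I → Fin b → 𝔽) (q : Fin K → Fin N → 𝔽) (s : Fin S) (t : Fin b) :
    serverSignal a (serverStore x w u) q (finSumFinEquiv (Sum.inr (finProdFinEquiv (s, t)))) =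
      share x (combine a q (slotCoeff (fileLayer w t) (keyLayer u t)) s) := by
  rw [serverSignal_apply, map_combine]
  simp only [serverStore_apply]

/-- `exists_masking_keys` is applied independently at each position `t`; linearity then moves the
files to `0` without changing the contents on `T` or any signal. -/
lemma exists_key_translation (a : Fin F → Fin K → Option (Fin S)) {α : Fin H → 𝔽}
    (hα : Function.Injective α) (hα0 : ∀ h, α h ≠ 0)
    (T : Finset (Fin H)) (hT : T.card ≤ I) (q : Fin K → Fin N → 𝔽)
    (w : Fin N → Fin (L * F * b) → 𝔽) :
    ∃ c : KeyIndex N F S L I → Fin b → 𝔽, ∀ u,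
      (∀ h ∈ T, serverStore (α h) w (u + c) = serverStore (α h) 0 u) ∧
      ∀ h, serverSignal a (serverStore (α h) w (u + c)) q =
        serverSignal a (serverStore (α h) 0 u) q := by
  choose κ hκ hκ' using fun t => exists_masking_keys (I := I) a q hα hα0 T hT (fileLayer w t)
  refine ⟨fun v t => κ t v, fun u => ⟨fun h hh => ?_, fun h => ?_⟩⟩
  · have h0 : serverStore (α h) w (fun v t => κ t v) = 0 := by
      ext i
      exact hκ _ h hh _
    have := serverStore_add (α h) 0 w u (fun v t => κ t v)
    rwa [zero_add, h0, add_zero] at this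
  · ext i
    obtain ⟨i, rfl⟩ := finSumFinEquiv.surjective i
    rcases i with i | i <;> obtain ⟨⟨i, t⟩, rfl⟩ := finProdFinEquiv.surjective i
    · rw [serverSignal_header, serverSignal_header]
    · rw [serverSignal_serverStore_apply, serverSignal_serverStore_apply]
      have : slotCoeff (fileLayer w t) (keyLayer (u + fun v t => κ t v) t) =
          fun i => slotCoeff (fileLayer 0 t) (keyLayer u t) i +
            slotCoeff (fileLayer w t) (κ t) i := by
        ext1 i
        rw [← slotCoeff_add]
        congr 1
        exact (zero_add _).symm
      rw [this, combine_add, hκ', add_zero]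

lemma file_eq_of_serverStore_eq {α : Fin H → 𝔽} (hα : Function.Injective α) (T : Finset (Fin H))
    (hT : L + I ≤ T.card) (w w' : Fin N → Fin (L * F * b) → 𝔽)
    (u u' : KeyIndex N F S L I → Fin b → 𝔽)
    (h : ∀ h ∈ T, serverStore (α h) w u = serverStore (α h) w' u') : w = w' := by
  ext n i
  obtain ⟨⟨m, t⟩, rfl⟩ := finProdFinEquiv.surjective i
  obtain ⟨⟨l, j⟩, rfl⟩ := finProdFinEquiv.surjective m
  have := eq_zero_of_share_eq_zero hα T hT
    (slotCoeff (fileLayer (w - w') t) (keyLayer (u - u') t) (Sum.inl (n, j))) fun i hi => by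
      rw [← serverStore_apply]
      have h1 := serverStore_add (α i) (w - w') w' (u - u') u'
      rw [sub_add_cancel, sub_add_cancel, h i hi] at h1
      rw [right_eq_add.1 h1]
      rfl
  exact sub_eq_zero.1 (congrFun this (Sum.inl l))

/-- One signal already reveals all queries, hence equal pads `p k` once the demands of user `k`
agree. With the same queries and pad, signals and cache are linear in files and keys, so the claim
reduces to `demanded_eq_zero` for the differences. -/
lemma demanded_eq_of_serverSignal_eq {α : Fin H → 𝔽} (hα : Function.Injective α)
    (T : Finset (Fin H)) (hT : L + I ≤ T.card) (hT0 : T.Nonempty) (k : Fin K)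
    (w w' : Fin N → Fin (L * F * b) → 𝔽) (u u' : KeyIndex N F S L I → Fin b → 𝔽)
    (e e' p p' : Fin K → Fin N → 𝔽) (he : e k = e' k)
    (hC : userCache ha k (p k) u w = userCache ha k (p' k) u' w')
    (h : ∀ h ∈ T, serverSignal a (serverStore (α h) w u) (fun k => e k + p k) =
      serverSignal a (serverStore (α h) w' u') fun k => e' k + p' k) :
    ∑ n, e k n • w n = ∑ n, e' k n • w' n := by
  obtain ⟨h₀, hh₀⟩ := hT0
  have hq : (fun k => e k + p k) = fun k => e' k + p' k := by
    ext k n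
    have := congrFun (h h₀ hh₀) (finSumFinEquiv (Sum.inl (finProdFinEquiv (k, n))))
    rwa [serverSignal_header, serverSignal_header] at this
  have hp : p k = p' k := by
    have : e k + p k = e' k + p' k := congrFun hq k
    rwa [he, add_right_inj] at this
  ext i
  obtain ⟨⟨m, t⟩, rfl⟩ := finProdFinEquiv.surjective i
  obtain ⟨⟨l, j⟩, rfl⟩ := finProdFinEquiv.surjective m
  have hw : fileLayer w t = fileLayer (w - w') t + fileLayer w' t := by
    ext; simp [fileLayer]
  have hu : keyLayer u t = keyLayer (u - u') t + keyLayer u' t := by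
    ext; simp [keyLayer]
  have hs : slotCoeff (fileLayer w t) (keyLayer u t) = fun i =>
      slotCoeff (fileLayer (w - w') t) (keyLayer (u - u') t) i +
        slotCoeff (fileLayer w' t) (keyLayer u' t) i := by
    ext1 i
    rw [← slotCoeff_add, hw, hu]
  have := demanded_eq_zero (fun k => e k + p k) ha k (e k) (p k) rfl (fileLayer (w - w') t)
    (keyLayer (u - u') t) (fun s => eq_zero_of_share_eq_zero hα T hT _ fun h' hh => by
      have h1 := congrFun (h h' hh) (finSumFinEquiv (Sum.inr (finProdFinEquiv (s, t))))
      rw [serverSignal_serverStore_apply, serverSignal_serverStore_apply, ← hq, hs, combine_add,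
        map_add] at h1
      exact add_eq_right.1 h1)
    (fun i => by
      have h1 := congrFun hC
        (finProdFinEquiv (Fintype.equivFinOfCardEq (card_cacheIndex a ha k) i, t))
      rw [userCache_apply, userCache_apply, ← hp, hw, hu, cacheSymbol_add] at h1
      exact add_eq_right.1 h1) l j
  rw [Finset.sum_apply, Finset.sum_apply, ← sub_eq_zero, ← Finset.sum_sub_distrib, ← he]
  simpa [fileLayer, mul_sub] using this

variable [Fintype 𝔽]

/-- The scheme that shares the files and the signal keys by ramp secret sharing with evaluation
points `α h`, and delivers according to the array `a`. -/
noncomputable abbrev lfrScheme (α : Fin H → 𝔽) {a : Fin F → Fin K → Option (Fin S)}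
    (ha : IsPDA Z a) (N L I b : ℕ) : Scheme 𝔽 N K H (L * F * b) where
  U := KeyIndex N F S L I → Fin b → 𝔽
  P := Fin N → 𝔽
  finiteP := inferInstance
  lawU := by classical exact PMF.uniformOfFintype _
  lawP _ := by classical exact PMF.uniformOfFintype _
  storeLen := Fintype.card (Slot N F S) * b
  cacheLen := (Z * (N * L) + (F - Z) * L) * b
  queryLen _ _ := N
  loadLen _ := K * N + S * b
  store h := serverStore (α h)
  cache := userCache ha
  query _ _ e p := e + p
  signal _ := serverSignal a

lemma lfrScheme_obliviousRecovery {α : Fin H → 𝔽} (hα : Function.Injective α) {A J : ℕ}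
    (hJ : L + I + 2 * A ≤ J) : (lfrScheme α ha N L I b).ObliviousRecovery A J := by
  intro 𝓙 h𝓙
  obtain ⟨dec, hdec⟩ := exists_error_correcting_decoder (β := fun _ => Fin _ → 𝔽) 𝓙 A
    (fun (i : (Fin N → Fin (L * F * b) → 𝔽) × (KeyIndex N F S L I → Fin b → 𝔽)) h =>
      serverStore (α h) i.1 i.2) Prod.fst
    (fun i i' T _ hT h => file_eq_of_serverStore_eq hα T (by omega) _ _ _ _ h)
  exact ⟨dec, fun 𝓐 h𝓐 w x _ z => hdec 𝓐 h𝓐 (w, x) z⟩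

lemma lfrScheme_obliviousDecoding {α : Fin H → 𝔽} (hα : Function.Injective α) {A J : ℕ}
    (hL : 0 < L) (hJ : L + I + 2 * A ≤ J) :
    (lfrScheme α ha N L I b).ObliviousDecoding A J := by
  intro k 𝓙 h𝓙
  -- Demand and cache arrive uncorrupted, so each pair of their values gets its own code, indexed by
  -- the states compatible with it.
  choose dec hdec using
    fun (e₀ : Fin N → 𝔽) (c₀ : Fin ((Z * (N * L) + (F - Z) * L) * b) → 𝔽) =>
    exists_error_correcting_decoder (β := fun _ => Fin (K * N + S * b) → 𝔽) 𝓙 A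
      (fun (i : {i : (Fin N → Fin (L * F * b) → 𝔽) × (Fin K → Fin N → 𝔽) × (Fin K → Fin N → 𝔽) ×
        (KeyIndex N F S L I → Fin b → 𝔽) // i.2.1 k = e₀ ∧
          userCache ha k (i.2.2.1 k) i.2.2.2 i.1 = c₀}) h =>
        serverSignal a (serverStore (α h) i.1.1 i.1.2.2.2) fun k => i.1.2.1 k + i.1.2.2.1 k)
      (fun i => ∑ n, i.1.2.1 k n • i.1.1 n)
      (fun i i' T _ hT h => demanded_eq_of_serverSignal_eq ha hα T (by omega)
        (Finset.card_pos.1 (by omega)) k _ _ _ _ _ _ _ _ (i.2.1.trans i'.2.1.symm)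
        (i.2.2.trans i'.2.2.symm) h)
  exact ⟨fun r e c => dec e c r, fun 𝓐 h𝓐 w e p _ x _ y =>
    hdec (e k) _ 𝓐 h𝓐 ⟨(w, e, p, x), rfl, rfl⟩ y⟩

lemma lfrScheme_hasSubpacketization (α : Fin H → 𝔽) :
    (lfrScheme α ha N L I b).HasSubpacketization (L * F) := by
  choose sc sd hs using fun (h : Fin H) (i : Fin (Fintype.card (Slot N F S))) =>
    exists_coeff_of_linear
      (fun (w : Fin N → Fin (L * F) → 𝔽) (κ : Fin (Fintype.card (KeyIndex N F S L I)) → 𝔽) =>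
        share (α h) (slotCoeff w (κ ∘ Fintype.equivFin _) ((Fintype.equivFin _).symm i)))
      (fun w w' κ κ' =>
        (congrArg (share (α h)) (slotCoeff_add _ _ _ _ _)).trans (map_add _ _ _))
      (fun r w κ =>
        (congrArg (share (α h)) (slotCoeff_smul r _ _ _)).trans (map_smul _ _ _))
  choose cc cd hc using fun (k : Fin K) (p : Fin N → 𝔽) (i : Fin (Z * (N * L) + (F - Z) * L)) =>
    exists_coeff_of_linear
      (fun (w : Fin N → Fin (L * F) → 𝔽) (κ : Fin (Fintype.card (KeyIndex N F S L I)) → 𝔽) =>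
        cacheSymbol a k p w (κ ∘ Fintype.equivFin _)
          ((Fintype.equivFinOfCardEq (card_cacheIndex a ha k)).symm i))
      (fun w w' κ κ' => cacheSymbol_add _ _ _ _ _ _ _ _)
      (fun r w κ => cacheSymbol_smul _ _ _ _ _ _ _)
  have hκ : ∀ (x : KeyIndex N F S L I → Fin b → 𝔽) (t : Fin b),
      (fun v => x ((Fintype.equivFin _).symm v) t) ∘ Fintype.equivFin _ = keyLayer x t := by
    intro x t; ext v; simp [keyLayer]
  exact ⟨{
    b := b
    fileSplit := finProdFinEquiv.symm
    numKeys := Fintype.card (KeyIndex N F S L I)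
    keyPacket := fun x v => x ((Fintype.equivFin _).symm v)
    numStore := Fintype.card (Slot N F S)
    storeSplit := fun _ => finProdFinEquiv.symm
    storeFile := sc
    storeKey := sd
    store_eq := fun h w x i t => by
      refine Eq.trans ?_ (hs h i (fileLayer w t) fun v => x ((Fintype.equivFin _).symm v) t)
      erw [hκ]
      simp [serverStore]
    -- The pad need not be cached: user `k` finds it by subtracting the demand from the query
    -- repeated in the signals.
    cacheHead := 0
    numCache := Z * (N * L) + (F - Z) * L
    cacheSplit := fun _ => finProdFinEquiv.symm.trans (Equiv.emptySum (Fin 0) _).symm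
    cacheHeader := fun _ _ => Fin.elim0
    cacheFile := cc
    cacheKey := cd
    cache_head := fun _ _ _ _ i => i.elim0
    cache_eq := fun k p x w i t => by
      refine Eq.trans ?_ (hc k p i (fileLayer w t) fun v => x ((Fintype.equivFin _).symm v) t)
      erw [hκ]
      simp [userCache]
    signalHead := fun _ => K * N
    numSignal := fun _ => S
    signalSplit := fun _ => finSumFinEquiv.symm.trans
      (Equiv.sumCongr (Equiv.refl _) finProdFinEquiv.symm)
    signalHeader := fun _ q i => q (finProdFinEquiv.symm i).1 (finProdFinEquiv.symm i).2
    signalCoeff := fun _ q s i =>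
      combine a q (fun i => (Pi.single i 1 : Slot N F S → 𝔽)) s ((Fintype.equivFin _).symm i)
    signal_head := fun h z q i => by
      obtain ⟨⟨k, n⟩, rfl⟩ := finProdFinEquiv.surjective i
      refine (serverSignal_header z q k n).trans ?_
      rw [Equiv.symm_apply_apply]
    signal_eq := fun h z q s t => by
      refine (serverSignal_apply z q s t).trans ((combine_eq_sum a q _ s).trans ?_)
      rw [← Equiv.sum_comp (Fintype.equivFin (Slot N F S)).symm]
      simp only [Equiv.apply_symm_apply]
      rfl }⟩

end LFRScheme

/-! ### Secrecy in a random operation of the scheme, and the achieved triple. -/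

section Operation

variable {𝔽 : Type u} [Field 𝔽] [Fintype 𝔽] {N K H F S Z L I b : ℕ} {α : Fin H → 𝔽}
  {a : Fin F → Fin K → Option (Fin S)} {ha : IsPDA Z a}
  {Ω : Type u} [MeasurableSpace Ω] {μ : Measure Ω}

namespace Scheme.Realization

/-- Uniform pads and keys make the right-hand side independent of `p` and `x`, as translation
arguments require. The demands stay a product over users, to be split along `𝓢` for demand privacy.
-/
lemma exists_prob_eq (ρ : (lfrScheme α ha N L I b).Realization μ) :
    ∃ (f : (Fin N → Fin (L * F * b) → 𝔽) → ℝ) (g : Fin K → (Fin N → 𝔽) → ℝ) (c : ℝ),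
      ∀ w e p x, prob μ (fun ω => (ρ.W ω, ρ.d ω, ρ.P ω, ρ.U ω)) (w, e, p, x) =
        f w * (∏ k, g k (e k)) * c := by
  classical
  refine ⟨fun w => (∏ n, μ {ω | ρ.W ω n = w n}).toReal, fun k v => (μ {ω | ρ.d ω k = v}).toReal,
    ((∏ _k : Fin K, (Fintype.card (Fin N → 𝔽) : ENNReal)⁻¹) *
      (Fintype.card (KeyIndex N F S L I → Fin b → 𝔽) : ENNReal)⁻¹).toReal, fun w e p x => ?_⟩
  have h : (fun ω => (ρ.W ω, ρ.d ω, ρ.P ω, ρ.U ω)) ⁻¹' {(w, e, p, x)} =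
      {ω | ρ.W ω = w ∧ ρ.d ω = e ∧ ρ.P ω = p ∧ ρ.U ω = x} := by
    ext ω; simp
  have hP : ∀ k, μ {ω | ρ.P ω k = p k} = (Fintype.card (Fin N → 𝔽) : ENNReal)⁻¹ := fun k =>
    (ρ.law_P k (p k)).trans (PMF.uniformOfFintype_apply _)
  have hU : μ {ω | ρ.U ω = x} =
      (Fintype.card (KeyIndex N F S L I → Fin b → 𝔽) : ENNReal)⁻¹ :=
    (ρ.law_U x).trans (PMF.uniformOfFintype_apply _)
  rw [prob, h, measureReal_def, ρ.indep, hU]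
  simp only [hP, ENNReal.toReal_mul, ENNReal.toReal_prod]
  ring

lemma isRV_state (ρ : (lfrScheme α ha N L I b).Realization μ) :
    IsRV (fun ω => (ρ.W ω, ρ.d ω, ρ.P ω, ρ.U ω)) :=
  ρ.isRV_W.prodMk (ρ.isRV_d.prodMk (ρ.isRV_P.prodMk ρ.isRV_U))

variable [IsProbabilityMeasure μ]

/-- What is unaffected by the translations of the client's randomness that compensate for a change
of the files is independent of the files. -/
lemma exists_factor_of_key_translation (ρ : (lfrScheme α ha N L I b).Realization μ) :
    ∃ f : (Fin N → Fin (L * F * b) → 𝔽) → ℝ, ∀ {γ : Type u}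
      (G : (Fin N → Fin (L * F * b) → 𝔽) → (Fin K → Fin N → 𝔽) → (Fin K → Fin N → 𝔽) →
        (KeyIndex N F S L I → Fin b → 𝔽) → γ),
      (∀ w e p, ∃ c, ∀ x, G w e p (x + c) = G 0 e p x) →
      ∃ φ : γ → ℝ, ∀ w g, prob μ (fun ω => (ρ.W ω, G (ρ.W ω) (ρ.d ω) (ρ.P ω) (ρ.U ω))) (w, g) =
        f w * φ g := by
  classical
  obtain ⟨f, g, c, h⟩ := ρ.exists_prob_eq
  refine ⟨f, fun {γ} G hG => ?_⟩
  refine exists_factor_of_translation (U := ρ.U) (𝓤 := KeyIndex N F S L I → Fin b → 𝔽)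
    (E := fun ω => (ρ.d ω, ρ.P ω)) ρ.isRV_W
    (ρ.isRV_d.prodMk ρ.isRV_P) ρ.isRV_U f (fun e => (∏ k, g k (e.1 k)) * c) ?_ 0
    (fun w e x => G w e.1 e.2 x) fun w e => hG w e.1 e.2
  rintro w ⟨e, p⟩ x
  rw [← mul_assoc, ← h w e p x]
  simp only [prob]
  congr 1
  ext ω
  simp [and_assoc]

lemma serverSecurity (hα : Function.Injective α) (hα0 : ∀ h, α h ≠ 0)
    (ρ : (lfrScheme α ha N L I b).Realization μ) : ρ.ServerSecurity I := by
  intro 𝓘 h𝓘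
  obtain ⟨f, hf⟩ := ρ.exists_factor_of_key_translation
  obtain ⟨φ, hφ⟩ := hf (fun w _ _ x => 𝓘.restrict fun h => serverStore (α h) w x)
    fun w _ _ => by
      obtain ⟨c, hc⟩ := exists_key_translation a hα hα0 𝓘 h𝓘.le 0 w
      exact ⟨c, fun x => funext fun h => (hc x).1 h h.2⟩
  exact mutualInfo_eq_zero_of_factor ρ.isRV_W
    (ρ.isRV_state.comp fun z => 𝓘.restrict fun h => serverStore (α h) z.1 z.2.2.2) f φ hφ

/-- For each frozen adversarial word, a key translation for `T = 𝓐` preserves the contents of `𝓐`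
and all honest signals; this is where `A ≤ I` enters. The attack condition then allows averaging
over the word. -/
lemma signalSecurity (hα : Function.Injective α) (hα0 : ∀ h, α h ≠ 0) {A : ℕ} (hA : A ≤ I)
    (ρ : (lfrScheme α ha N L I b).Realization μ) : ρ.SignalSecurity A := by
  classical
  intro 𝓐 h𝓐 X' ⟨hX', hI⟩
  obtain ⟨f, hf⟩ := ρ.exists_factor_of_key_translation
  let extend (y : ∀ _ : 𝓐, Fin (K * N + S * b) → 𝔽) (h : Fin H) : Fin (K * N + S * b) → 𝔽 :=
    if hh : h ∈ 𝓐 then y ⟨h, hh⟩ else 0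
  choose φ hφ using fun y : ∀ _ : 𝓐, Fin (K * N + S * b) → 𝔽 => hf
    (fun w e p x =>
      (corrupt (β := fun _ => Fin (K * N + S * b) → 𝔽) 𝓐
          (fun h => serverSignal a (serverStore (α h) w x) fun k => e k + p k) (extend y),
        𝓐.restrict (fun h => serverStore (α h) w x),
        𝓐.restrict (fun _ k => e k + p k)))
    fun w e p => by
      obtain ⟨c, hc⟩ := exists_key_translation a hα hα0 𝓐 (h𝓐.trans hA) (fun k => e k + p k) w
      refine ⟨c, fun x => Prod.ext ?_ (Prod.ext ?_ rfl)⟩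
      · simp only [(hc x).2]
      · exact funext fun h => (hc x).1 h h.2
  have := mutualInfo_eq_zero_of_condMutualInfo_eq_zero
    (ρ.isRV_state.comp fun z => (z.1, (𝓐ᶜ).restrict (fun h => serverStore (α h) z.1 z.2.2.2),
      (𝓐ᶜ).restrict (fun (_ : Fin H) k => z.2.1 k + z.2.2.1 k), z.2.1))
    (hX'.comp 𝓐.restrict)
    (ρ.isRV_state.comp fun z => (𝓐.restrict (fun h => serverStore (α h) z.1 z.2.2.2),
      𝓐.restrict (fun (_ : Fin H) k => z.2.1 k + z.2.2.1 k))) hI Prod.fst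
    -- The honest signals are recomputed from the contents and queries outside `𝓐`, which belong to
    -- the variable that the attack condition decouples from the adversarial word.
    (fun m y h => if hh : h ∈ 𝓐 then y ⟨h, hh⟩ else
      serverSignal a (m.2.1 ⟨h, Finset.mem_compl.2 hh⟩) (m.2.2.1 ⟨h, Finset.mem_compl.2 hh⟩)) f
    (fun y r v => φ y (r, v)) fun y w r v => by
      rw [← hφ]
      congr 1
      funext ω
      refine Prod.ext rfl (Prod.ext ?_ rfl)
      funext h
      by_cases hh : h ∈ 𝓐 <;> simp [corrupt, extend, hh]
  rw [← this]
  congr 1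

/-- The hidden variable is now the demands outside `𝓢` and the uniform key is the tuple of pads.
Pads outside `𝓢` enter the observation only through the queries, where they absorb the demands. -/
lemma demandPrivacy (ρ : (lfrScheme α ha N L I b).Realization μ) : ρ.DemandPrivacy := by
  classical
  intro 𝓢
  obtain ⟨f, g, c, hprob⟩ := ρ.exists_prob_eq
  let merge (e : ∀ _ : ↥(𝓢ᶜ), Fin N → 𝔽) (e' : ∀ _ : 𝓢, Fin N → 𝔽) (k : Fin K) : Fin N → 𝔽 :=
    if hk : k ∈ 𝓢 then e' ⟨k, hk⟩ else e ⟨k, Finset.mem_compl.2 hk⟩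
  have merge_restrict : ∀ e : Fin K → Fin N → 𝔽,
      merge ((𝓢ᶜ).restrict e) (𝓢.restrict e) = e := fun e => by
    funext k
    by_cases hk : k ∈ 𝓢 <;> simp [merge, hk]
  have hd : IsRV fun ω => (𝓢ᶜ).restrict (ρ.d ω) := ρ.isRV_d.comp (𝓢ᶜ).restrict
  have hd' : IsRV fun ω => 𝓢.restrict (ρ.d ω) := ρ.isRV_d.comp 𝓢.restrict
  obtain ⟨φ, hφ⟩ := exists_factor_of_translation (U := ρ.P) (𝓤 := Fin K → Fin N → 𝔽)
    (E := fun ω => (ρ.W ω, 𝓢.restrict (ρ.d ω), ρ.U ω)) hd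
    (ρ.isRV_W.prodMk (hd'.prodMk ρ.isRV_U)) ρ.isRV_P
    (fun e => ∏ k : ↥(𝓢ᶜ), g k (e k)) (fun z => f z.1 * (∏ k : 𝓢, g k (z.2.1 k)) * c)
    (by
      rintro e ⟨w, e', x⟩ p
      have h1 : ∏ k, g k (merge e e' k) = (∏ k : 𝓢, g k (e' k)) * ∏ k : ↥(𝓢ᶜ), g k (e k) := by
        rw [← Finset.prod_mul_prod_compl 𝓢, ← Finset.prod_coe_sort 𝓢,
          ← Finset.prod_coe_sort 𝓢ᶜ]
        congr 1
        · exact Finset.prod_congr rfl fun k _ => by simp [merge]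
        · exact Finset.prod_congr rfl fun k _ => by
            simp [merge, Finset.mem_compl.1 k.2]
      have h2 := hprob w (merge e e') p x
      rw [h1] at h2
      dsimp only
      rw [show ∀ A B C D : ℝ, A * (B * C * D) = B * (C * A) * D from fun A B C D => by ring, ← h2]
      simp only [prob]
      congr 1
      ext ω
      simp only [Set.mem_preimage, Set.mem_singleton_iff, Prod.mk.injEq]
      constructor
      · rintro ⟨rfl, ⟨rfl, rfl, rfl⟩, rfl⟩
        exact ⟨rfl, (merge_restrict _).symm, rfl, rfl⟩
      · rintro ⟨rfl, h, rfl, rfl⟩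
        rw [h]
        refine ⟨?_, ⟨rfl, ?_, rfl⟩, rfl⟩
        · funext k
          simp [merge, Finset.mem_compl.1 k.2]
        · funext k
          simp [merge])
    0
    (fun e z p =>
      ((𝓢.restrict (fun k => userCache ha k (p k) z.2.2 z.1), z.2.1,
        (fun (_ : Fin H) k => merge e z.2.1 k + p k), fun h => serverStore (α h) z.1 z.2.2), z.1))
    (fun e z => by
      -- Shifting the pads outside `𝓢` by minus the demands gives the queries of zero demands; the
      -- pads in `𝓢`, hence the caches there, are untouched.
      refine ⟨fun k => if hk : k ∈ 𝓢 then 0 else - e ⟨k, Finset.mem_compl.2 hk⟩, fun p => ?_⟩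
      refine Prod.ext (Prod.ext ?_ (Prod.ext rfl (Prod.ext ?_ rfl))) rfl
      · funext k
        simp
      · funext _ k
        by_cases hk : k ∈ 𝓢 <;> simp [merge, hk])
  refine condMutualInfo_eq_zero_of_factor hd
    (ρ.isRV_state.comp fun z => (𝓢.restrict (fun k => userCache ha k (z.2.2.1 k) z.2.2.2 z.1),
      𝓢.restrict z.2.1, (fun (_ : Fin H) k => z.2.1 k + z.2.2.1 k),
      fun h => serverStore (α h) z.1 z.2.2.2)) ρ.isRV_W
    (fun e _ => ∏ k : ↥(𝓢ᶜ), g k (e k)) (fun y w => φ (y, w)) fun e y w => ?_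
  rw [← hφ]
  simp only [merge_restrict]
  rfl

end Scheme.Realization

lemma lfrScheme_isRSPLFRBA (hα : Function.Injective α) (hα0 : ∀ h, α h ≠ 0) {A J : ℕ}
    (hA : A ≤ I) (hL : 0 < L) (hJ : L + I + 2 * A ≤ J) :
    (lfrScheme α ha N L I b).IsRSPLFRBA A I J := by
  classical
  have hrec := lfrScheme_obliviousRecovery (N := N) (b := b) ha hα hJ
  have hdec := lfrScheme_obliviousDecoding (N := N) (b := b) ha hα hL hJ
  refine ⟨fun μ _ ρ => ⟨ρ.serverSecurity hα hα0, ?_, ?_, ρ.signalSecurity hα hα0 hA,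
    ρ.demandPrivacy⟩, hrec, hdec⟩
  · intro 𝓐 𝓙 h𝓐 h𝓙 Z' _
    obtain ⟨dec, h⟩ := hrec 𝓙 h𝓙
    exact condEntropy_eq_zero_of_eq_comp dec fun ω =>
      (h 𝓐 h𝓐 (ρ.W ω) (ρ.U ω) (PMF.mem_support_uniformOfFintype _) (Z' ω)).symm
  · intro k 𝓐 𝓙 h𝓐 h𝓙 X' _
    obtain ⟨dec, h⟩ := hdec k 𝓙 h𝓙
    exact condEntropy_eq_zero_of_eq_comp (fun y => dec y.1 y.2.1 y.2.2) fun ω =>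
      (h 𝓐 h𝓐 (ρ.W ω) (ρ.d ω) (ρ.P ω) (fun _ => PMF.mem_support_uniformOfFintype _) (ρ.U ω)
        (PMF.mem_support_uniformOfFintype _) (X' ω)).symm

lemma IsPDA.stars_le {Z : ℕ} {a : Fin F → Fin K → Option (Fin S)} (ha : IsPDA Z a) (hK : 0 < K) :
    Z ≤ F := by
  rw [← ha.stars ⟨0, hK⟩]
  exact (Finset.card_le_univ _).trans_eq (Fintype.card_fin F)

lemma lfrScheme_achieves (α : Fin H → 𝔽) (ha : IsPDA Z a) (hN : 0 < N) (hK : 0 < K) (hF : 0 < F)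
    (hL : 0 < L) (I : ℕ) :
    Scheme.Achieves (fun b => lfrScheme α ha N L I b) (1 + (Z : ℝ) / F * (N - 1))
      (1 / (L : ℝ) * (N + (S : ℝ) / F)) ((S : ℝ) / (L * F)) := by
  have hZ := ha.stars_le hK
  have hF' : (0 : ℝ) < F := by exact_mod_cast hF
  have hL' : (0 : ℝ) < L := by exact_mod_cast hL
  have hN' : (1 : ℝ) ≤ N := by exact_mod_cast hN
  have hZF : (Z : ℝ) / F ≤ 1 := (div_le_one hF').2 (by exact_mod_cast hZ)
  have hZ0 : (0 : ℝ) ≤ (Z : ℝ) / F := by positivity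
  refine ⟨⟨by nlinarith, by nlinarith, by positivity, by positivity⟩, fun ε hε => ?_⟩
  -- Memory and storage match the triple exactly for every `b > 0`; only the load exceeds it, by `K
  -- * N / (L * F * b)` for the repeated queries, and `b₀` makes this less than `ε`.
  obtain ⟨b₀, hb₀⟩ := exists_nat_gt ((K * N : ℝ) / (L * F) / ε)
  refine ⟨b₀ + 1, fun b hb => ?_⟩
  have hb' : (0 : ℝ) < b := by exact_mod_cast (by omega : 0 < b)
  have hbb : (b₀ : ℝ) ≤ b := by exact_mod_cast (by omega : b₀ ≤ b)
  refine ⟨?_, ?_, ?_⟩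
  · refine lt_of_eq_of_lt ?_ (lt_add_of_pos_right _ hε)
    simp only [Scheme.memorySize]
    push_cast [Nat.cast_sub hZ]
    field_simp
    ring
  · refine lt_of_eq_of_lt ?_ (lt_add_of_pos_right _ hε)
    simp only [Scheme.storageSize, Fintype.card_sum, Fintype.card_prod, Fintype.card_fin]
    push_cast
    field_simp
  · have h1 : (Finset.univ.sup (lfrScheme α ha N L I b).loadLen : ℕ) ≤ K * N + S * b :=
      Finset.sup_le fun _ _ => le_rfl
    have h2 : (lfrScheme α ha N L I b).commLoad ≤ (K * N + S * b : ℝ) / (L * F * b) := by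
      rw [Scheme.commLoad]
      push_cast
      gcongr
      exact_mod_cast h1
    have h3 : (K * N : ℝ) / (L * F) / b < ε := by
      rw [div_lt_comm₀ hb' hε]
      exact hb₀.trans_le hbb
    have h4 : (K * N + S * b : ℝ) / (L * F * b) = S / (L * F) + (K * N : ℝ) / (L * F) / b := by
      field_simp
      ring
    linarith

end Operation

theorem theorem1 {𝔽 : Type u} [Field 𝔽] [Fintype 𝔽]
    (N K H A I J : ℕ) (hN : 2 ≤ N) (hK : 0 < K) (hA : 0 < A)
    (hAI : A ≤ I) (hIJ : I + 2 * A < J) (hJH : J ≤ H) (hq : H < Fintype.card 𝔽)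
    (F Z S : ℕ) (hF : 0 < F) (a : Fin F → Fin K → Option (Fin S)) (ha : IsPDA Z a)
    (L : ℕ) (hL : L = J - I - 2 * A) :
    ∃ σ : ∀ b : ℕ, Scheme 𝔽 N K H (L * F * b),
      (∀ b > 0, (σ b).IsRSPLFRBA A I J ∧ (σ b).HasSubpacketization (L * F)) ∧
      Scheme.Achieves σ (1 + (Z : ℝ) / F * (N - 1)) (1 / (L : ℝ) * (N + (S : ℝ) / F))
        ((S : ℝ) / (L * F)) := by
  classical
  -- Since `H < q`, the `q - 1` units suffice for distinct nonzero evaluation points.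
  obtain ⟨α⟩ : Nonempty (Fin H ↪ 𝔽ˣ) := Function.Embedding.nonempty_of_card_le (by
    rw [Fintype.card_fin, Fintype.card_units]
    omega)
  have hL0 : 0 < L := by omega
  exact ⟨fun b => lfrScheme (fun h => (α h : 𝔽)) ha N L I b,
    fun b _ => ⟨lfrScheme_isRSPLFRBA (Units.val_injective.comp α.injective)
      (fun h => (α h).ne_zero) hAI hL0 (by omega), lfrScheme_hasSubpacketization ha _⟩,
    lfrScheme_achieves _ ha (by omega) hK hF hL0 I⟩
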